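/- Let $q$ be a prime power, $K=\mathbb{F}_q(\theta)$, $|\cdot|$ the absolute value of $K$ at $\infty$ with $|\theta|=q$, $K_\infty$ the completion of $K$, and $\mathbb{C}_\infty$ the completion of an algebraic closure of $K_\infty$; put $A=\mathbb{F}_q[\theta]$. Let $\mathbb{T}\subset\mathbb{C}_\infty[[t]]$ be the Tate algebra of power series whose coefficients tend to $0$. For $f=\sum_i a_it^i$ put $f^{(1)}=\sum_i a_i^{q}t^i$ and $\wp(f)=f-f^{(1)}$. Fix a $(q-1)$-th root of $-\theta$ and put $$\Omega(t)=(-\theta)^{\frac{-q}{q-1}}\prod_{i\ge 1}\Bigl(1-\frac{t}{\theta^{q^i}}\Bigr),\qquad \tilde\pi=\frac1{\Omega(\theta)},\qquad L_i=\prod_{k=1}^{i}(\theta-\theta^{q^k}).$$ For $m\ge 1$ and positive integers $n_1,\dots,n_m$ let $$\mathrm{Li}^\star_{n_1,\dots,n_m}(z_1,\dots,z_m)=\sum_{0\le i_1\le\cdots\le i_m}\frac{z_1^{q^{i_1}}\cdots z_m^{q^{i_m}}}{L_{i_1}^{n_1}\cdots L_{i_m}^{n_m}},$$ which converges exactly on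 the set $\mathbb{D}^\star_{n_1,\dots,n_m}$ of all $(z_1,\dots,z_m)\in\mathbb{C}_\infty^m$ with $\prod_{j}\bigl|z_j/\theta^{\frac{qn_j}{q-1}}\bigr|^{q^{i_j}}\to0$ as $0\le i_1\le\cdots\le i_m\to\infty$. Fix $d\ge1$, positive integers $n_1,\dots,n_d$ and $z_1,\dots,z_{d-1}\in\mathbb{C}_\infty$; put $N=n_1+\cdots+n_d$ and $Z_j=\Omega^{n_j}z_j\in\mathbb{T}$ for $j<d$. Let $\mathbb{M}_0\subset\mathbb{T}^d$ be the $\mathbb{F}_q[t]$-submodule generated by all vectors $(g_1,\dots,g_k,1,0,\dots,0)\in\mathbb{T}^d$ with $0\le k\le d-1$ and $\wp(g_j)=Z_jg_{j+1}$ for $1\le j\le k$, where $g_{k+1}=1$. The monodromy module $M^\star=M^{\star,z_1,\dots,z_{d-1}}_{n_1,\dots,n_d}$ is the $A$-submodule of $\mathbb{C}_\infty^d$ obtained by evaluating $\mathbb{M}:=\Omega^{-N}\mathbb{M}_0$ at $t=\theta$. For $z_d\in\mathbb{C}_\infty$ choose any $(h_1,\dots,h_d)\in\mathbb{T}^d$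 with $\wp(h_j)=Z_jh_{j+1}$ for $1\le j<d$ and $\wp(h_d)=\Omega^{n_d}z_d$ (such a vector exists), and let $$\vec{\mathrm{Li}}^{\star}_{n_1,\dots,n_d}(z_1,\dots,z_{d-1},z_d)\in\mathbb{C}_\infty^d/M^\star$$ be the class of $\bigl(\Omega^{-N}(h_1,\dots,h_d)\bigr)|_{t=\theta}$. Then the series $\Omega^{-N}h_j$ converge at $t=\theta$, and $\vec{\mathrm{Li}}^{\star}_{n_1,\dots,n_d}(z_1,\dots,z_{d-1},-):\mathbb{C}_\infty\to\mathbb{C}_\infty^d/M^\star$ is a well-defined (independent of the choice of $(h_j)$) $\mathbb{F}_q$-linear map, and: (1) If $(z_1,\dots,z_d)\in\mathbb{D}^\star_{n_1,\dots,n_d}$ and, moreover, either $z_1,\dots,z_{d-1}$ are all nonzero or all the series in the following tuple converge (that is, $(z_j,\dots,z_d)\in\mathbb{D}^\star_{n_j,\dots,n_d}$ for all $1\le j\le d$), then $$\vec{\mathrm{Li}}^{\star}_{n_1,\dots,n_d}(z_1,\dots,z_d)\equiv\bigl(\mathrm{Li}^\star_{n_1,\dots,n_d}(z_1,\dots,z_d),\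 \tilde\pi^{n_1}\mathrm{Li}^\star_{n_2,\dots,n_d}(z_2,\dots,z_d),\ \dots,\ \tilde\pi^{n_1+\cdots+n_{d-1}}\mathrm{Li}^\star_{n_d}(z_d)\bigr)^{\mathtt T}\pmod{M^\star}.$$ (2) The map $\vec{\mathrm{Li}}^{\star}_{n_1,\dots,n_d}(z_1,\dots,z_{d-1},-)$ is locally rigid-analytic: for each $x_0\in\mathbb{C}_\infty$ there are a closed disk $U\subset\mathbb{C}_\infty$ containing $x_0$ and a closed polydisk $V\subset\mathbb{C}_\infty^d$ (of positive radii in $|\mathbb{C}_\infty^\times|$) such that $V$ injects into $\mathbb{C}_\infty^d/M^\star$, the image of $V$ contains the image of $U$, and the induced map $U\to V$ is given in each coordinate by a rigid-analytic function, i.e. by a power series in $x-x_0$ converging on all of $U$. -/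

import Mathlib

open Filter Topology
namespace CarlitzStar
noncomputable section

open Classical in
/-- The absolute value at the infinite place of `K = 𝔽_q(θ)`: `|f/g| = q ^ (deg f - deg g)`,
where `q` is the number of elements of `F`. -/
def inftyAbs (F : Type*) [Field F] [Fintype F] : AbsoluteValue (RatFunc F) ℝ where
  toFun x := if x = 0 then 0 else (Fintype.card F : ℝ) ^ x.intDegree
  map_mul' x y := by
    by_cases hx : x = 0
    · simp [hx]
    by_cases hy : y = 0
    · simp [hy]
    have hq : (Fintype.card F : ℝ) ≠ 0 := by simp
    simp only [hx, hy, mul_eq_zero, or_self, if_false, RatFunc.intDegree_mul hx hy]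
    exact zpow_add₀ hq _ _
  nonneg' x := by
    split_ifs <;> positivity
  eq_zero' x := by
    have hq : (Fintype.card F : ℝ) ≠ 0 := by simp
    by_cases hx : x = 0
    · simp [hx]
    · simp only [hx, if_false, iff_false]
      exact zpow_ne_zero _ hq
  add_le' x y := by
    have hq : (1 : ℝ) ≤ Fintype.card F := by exact_mod_cast Fintype.card_pos
    have hq0 : (0 : ℝ) < Fintype.card F := lt_of_lt_of_le one_pos hq
    by_cases hx : x = 0
    · simp [hx]
    by_cases hy : y = 0
    · simp [hy]
    by_cases hxy : x + y = 0
    · simp only [hxy, hx, hy, if_true, if_false]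
      positivity
    · simp only [hxy, hx, hy, if_false]
      have h := zpow_le_zpow_right₀ hq (RatFunc.intDegree_add_le hy hxy)
      refine h.trans ?_
      rcases max_cases x.intDegree y.intDegree with ⟨h1, _⟩ | ⟨h1, _⟩ <;> rw [h1]
      · exact le_add_of_nonneg_right (by positivity)
      · exact le_add_of_nonneg_left (by positivity)

lemma inftyAbs_X (F : Type*) [Field F] [Fintype F] :
    inftyAbs F RatFunc.X = Fintype.card F := by
  simp [inftyAbs, RatFunc.X_ne_zero]

open Classical in
lemma inftyAbs_add_le (F : Type*) [Field F] [Fintype F] (x y : RatFunc F) :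
    inftyAbs F (x + y) ≤ max (inftyAbs F x) (inftyAbs F y) := by
  have hq : (1 : ℝ) ≤ Fintype.card F := by exact_mod_cast Fintype.card_pos
  by_cases hx : x = 0
  · simp [hx]
  by_cases hy : y = 0
  · simp [hy]
  by_cases hxy : x + y = 0
  · rw [hxy, map_zero]
    exact le_max_of_le_left ((inftyAbs F).nonneg x)
  · change (if x + y = 0 then (0:ℝ) else _) ≤ max (if x = 0 then (0:ℝ) else _)
      (if y = 0 then (0:ℝ) else _)
    simp only [hxy, hx, hy, if_false]
    have h := zpow_le_zpow_right₀ hq (RatFunc.intDegree_add_le hy hxy)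
    refine h.trans ?_
    rcases max_cases x.intDegree y.intDegree with ⟨h1, _⟩ | ⟨h1, _⟩ <;> rw [h1]
    · exact le_max_left _ _
    · exact le_max_right _ _

/-- The completion `K_∞` of `K = 𝔽_q(θ)` at the infinite place. -/
abbrev KInfty (F : Type*) [Field F] [Fintype F] := (inftyAbs F).Completion

instance (F : Type*) [Field F] [Fintype F] : IsUltrametricDist (WithAbs (inftyAbs F)) :=
  IsUltrametricDist.isUltrametricDist_of_forall_norm_add_le_max_norm fun x y =>
    inftyAbs_add_le F x.ofAbs y.ofAbs

instance (F : Type*) [Field F] [Fintype F] : IsUltrametricDist (KInfty F) := by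
  apply IsUltrametricDist.isUltrametricDist_of_forall_norm_add_le_max_norm
  intro x y
  induction x, y using UniformSpace.Completion.induction_on₂ with
  | hp => exact isClosed_le (by fun_prop) (by fun_prop)
  | ih x y =>
    rw [← UniformSpace.Completion.coe_add]
    simpa only [UniformSpace.Completion.norm_coe] using IsUltrametricDist.norm_add_le_max x y

instance (F : Type*) [Field F] [Fintype F] : NontriviallyNormedField (KInfty F) where
  __ := (inferInstance : NormedField (KInfty F))
  non_trivial := ⟨((WithAbs.toAbs (inftyAbs F) RatFunc.X : WithAbs (inftyAbs F)) : KInfty F), by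
    have h : ‖(WithAbs.toAbs (inftyAbs F) RatFunc.X : WithAbs (inftyAbs F))‖
        = (Fintype.card F : ℝ) := inftyAbs_X F
    have h2 : (1 : ℝ) < Fintype.card F := by exact_mod_cast Fintype.one_lt_card
    simpa only [UniformSpace.Completion.norm_coe, h] using h2⟩

/-- An algebraic closure of `K_∞`. -/
abbrev KInftyBar (F : Type*) [Field F] [Fintype F] := AlgebraicClosure (KInfty F)

/-- The unique extension of the absolute value of `K_∞` to its algebraic closure. -/
instance (F : Type*) [Field F] [Fintype F] : NormedField (KInftyBar F) :=
  spectralNorm.normedField (KInfty F) (KInftyBar F)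

instance (F : Type*) [Field F] [Fintype F] : IsUltrametricDist (KInftyBar F) :=
  IsUltrametricDist.isUltrametricDist_of_forall_norm_add_le_max_norm
    (isNonarchimedean_spectralNorm (K := KInfty F) (L := KInftyBar F))

/-- The field `ℂ_∞`, the completion of an algebraic closure of `K_∞`. -/
def CInfty (F : Type*) [Field F] [Fintype F] := UniformSpace.Completion (KInftyBar F)

/-- The canonical embedding `K → ℂ_∞`. -/
def ofRatFunc (F : Type*) [Field F] [Fintype F] :
    RatFunc F →+* UniformSpace.Completion (KInftyBar F) :=
  (UniformSpace.Completion.coeRingHom (α := KInftyBar F)).comp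
    ((algebraMap (KInfty F) (KInftyBar F)).comp
      ((UniformSpace.Completion.coeRingHom (α := WithAbs (inftyAbs F))).comp
        (WithAbs.equiv (inftyAbs F)).symm.toRingHom))

lemma norm_ofRatFunc (F : Type*) [Field F] [Fintype F] (x : RatFunc F) :
    ‖ofRatFunc F x‖ = inftyAbs F x := by
  change ‖((algebraMap (KInfty F) (KInftyBar F)
    ((WithAbs.toAbs (inftyAbs F) x : WithAbs (inftyAbs F)) : KInfty F) : KInftyBar F) :
      UniformSpace.Completion (KInftyBar F))‖ = _
  rw [UniformSpace.Completion.norm_coe]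
  refine (spectralNorm_extends (K := KInfty F) (L := KInftyBar F) _).trans ?_
  rw [UniformSpace.Completion.norm_coe]
  rfl

instance (F : Type*) [Field F] [Fintype F] : NontriviallyNormedField (CInfty F) where
  __ := (inferInstance : NormedField (UniformSpace.Completion (KInftyBar F)))
  non_trivial := ⟨ofRatFunc F RatFunc.X, by
    have h2 : (1 : ℝ) < Fintype.card F := by exact_mod_cast Fintype.one_lt_card
    refine h2.trans_eq ?_
    rw [← inftyAbs_X]
    exact (norm_ofRatFunc F _).symm⟩

instance (F : Type*) [Field F] [Fintype F] : CompleteSpace (CInfty F) :=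
  inferInstanceAs (CompleteSpace (UniformSpace.Completion (KInftyBar F)))

instance (F : Type*) [Field F] [Fintype F] : IsUltrametricDist (CInfty F) := by
  apply IsUltrametricDist.isUltrametricDist_of_forall_norm_add_le_max_norm
  change ∀ x y : UniformSpace.Completion (KInftyBar F), ‖x + y‖ ≤ max ‖x‖ ‖y‖
  intro x y
  induction x, y using UniformSpace.Completion.induction_on₂ with
  | hp => exact isClosed_le (by fun_prop) (by fun_prop)
  | ih x y =>
    rw [← UniformSpace.Completion.coe_add]
    simpa only [UniformSpace.Completion.norm_coe] using IsUltrametricDist.norm_add_le_max x y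

/-- `ℂ_∞` as an algebra over `𝔽_q`, through `𝔽_q ⊆ K ⊆ ℂ_∞`. -/
instance (F : Type*) [Field F] [Fintype F] : Algebra F (CInfty F) :=
  RingHom.toAlgebra ((ofRatFunc F).comp RatFunc.C : F →+* CInfty F)

/-- The embedding of the algebraic closure of `K_∞` into `ℂ_∞`. -/
def ofBar (F : Type*) [Field F] [Fintype F] : KInftyBar F →+* CInfty F :=
  UniformSpace.Completion.coeRingHom (α := KInftyBar F)

lemma denseRange_ofBar (F : Type*) [Field F] [Fintype F] : DenseRange (ofBar F) :=
  UniformSpace.Completion.denseRange_coe (α := KInftyBar F)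

/-- The element `θ` of `ℂ_∞`. -/
def theta (F : Type*) [Field F] [Fintype F] : CInfty F := ofRatFunc F RatFunc.X

lemma norm_theta (F : Type*) [Field F] [Fintype F] : ‖theta F‖ = Fintype.card F :=
  (norm_ofRatFunc F _).trans (inftyAbs_X F)


open PowerSeries

/-- The Tate algebra `𝕋`: power series in `t` over `ℂ_∞` whose coefficients tend to `0`. -/
def tate (F : Type*) [Field F] [Fintype F] : Subring (CInfty F)⟦X⟧ :=
  PowerSeries.IsRestricted.subring 1

lemma mem_tate {F : Type*} [Field F] [Fintype F] {f : (CInfty F)⟦X⟧} :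
    f ∈ tate F ↔ Tendsto (fun i => ‖coeff i f‖) atTop (𝓝 0) := by
  have h : f ∈ tate F ↔ PowerSeries.IsRestricted 1 f := Iff.rfl
  rw [h, PowerSeries.isRestricted_iff']
  simp

/-- The Frobenius twist `f ↦ f⁽¹⁾`, raising every coefficient to the power `q`. -/
def twist {F : Type*} [Field F] [Fintype F] (f : (CInfty F)⟦X⟧) : (CInfty F)⟦X⟧ :=
  PowerSeries.mk fun i => coeff i f ^ Fintype.card F

/-- The Artin-Schreier operator `℘(f) = f - f⁽¹⁾`. -/
def wp {F : Type*} [Field F] [Fintype F] (f : (CInfty F)⟦X⟧) : (CInfty F)⟦X⟧ := f - twist f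

/-- Partial products of `∏_{i ≥ 1} (1 - t / θ^(q^i))`. -/
def omegaPartial (F : Type*) [Field F] [Fintype F] (N : ℕ) : (CInfty F)⟦X⟧ :=
  ∏ i ∈ Finset.range N, (1 - C ((theta F ^ Fintype.card F ^ (i + 1))⁻¹) * X)

/-- `Ω = (-θ)^(-q/(q-1)) ∏_{i ≥ 1} (1 - t / θ^(q^i))`, where `ϖ` is the chosen `(q-1)`-th root
of `-θ`. The infinite product is the coefficientwise limit of its partial products. -/
def omega {F : Type*} [Field F] [Fintype F] (ϖ : CInfty F) : (CInfty F)⟦X⟧ :=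
  C ((ϖ ^ Fintype.card F)⁻¹) *
    PowerSeries.mk fun m => limUnder atTop fun N => coeff m (omegaPartial F N)

/-- Substitution `t = θ`. -/
def evalTheta {F : Type*} [Field F] [Fintype F] (f : (CInfty F)⟦X⟧) : CInfty F :=
  ∑' i, coeff i f * theta F ^ i

/-- The period `π̃ = 1 / Ω(θ)`. -/
def piTilde {F : Type*} [Field F] [Fintype F] (ϖ : CInfty F) : CInfty F :=
  1 / evalTheta (omega ϖ)

section aux
variable {F : Type*} [Field F] [Fintype F]

lemma one_lt_card : (1 : ℝ) < Fintype.card F := by exact_mod_cast Fintype.one_lt_card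

lemma norm_coeff_step (f : (CInfty F)⟦X⟧) (hf : ∀ m, ‖coeff m f‖ ≤ 1) (c : CInfty F) (m : ℕ) :
    ‖coeff m (f * (1 - C c * X)) - coeff m f‖ ≤ ‖c‖ := by
  have h : f * (1 - C c * X) = f - C c * (f * X) := by ring
  rw [h, map_sub, sub_sub_cancel_left, norm_neg, coeff_C_mul, norm_mul]
  refine mul_le_of_le_one_right (norm_nonneg _) ?_
  cases m with
  | zero => simp
  | succ m => rw [coeff_succ_mul_X]; exact hf m

lemma norm_coeff_omegaPartial (N m : ℕ) :
    ‖coeff m (omegaPartial F N)‖ ≤ ((Fintype.card F : ℝ)⁻¹) ^ m := by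
  have hq := one_lt_card (F := F)
  have hq0 : (0 : ℝ) < Fintype.card F := by linarith
  induction N generalizing m with
  | zero =>
    rw [omegaPartial, Finset.range_zero, Finset.prod_empty, coeff_one]
    split_ifs with h
    · simp [h]
    · simp only [norm_zero]; positivity
  | succ N ih =>
    rw [omegaPartial, Finset.prod_range_succ, ← omegaPartial]
    set c := (theta F ^ Fintype.card F ^ (N + 1))⁻¹
    have hc : ‖c‖ ≤ (Fintype.card F : ℝ)⁻¹ := by
      rw [norm_inv, norm_pow, norm_theta]
      exact inv_anti₀ hq0 (le_self_pow₀ hq.le (pow_ne_zero _ Fintype.card_ne_zero))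
    have h : omegaPartial F N * (1 - C c * X) = omegaPartial F N - C c * (omegaPartial F N * X) := by
      ring
    rw [h, map_sub, coeff_C_mul, sub_eq_add_neg]
    refine (IsUltrametricDist.norm_add_le_max _ _).trans (max_le (ih m) ?_)
    rw [norm_neg, norm_mul]
    cases m with
    | zero => simp
    | succ m =>
      rw [coeff_succ_mul_X, pow_succ']
      exact mul_le_mul hc (ih m) (norm_nonneg _) (by positivity)

lemma tendsto_omegaPartial (m : ℕ) :
    Tendsto (fun N => coeff m (omegaPartial F N)) atTop
      (𝓝 (limUnder atTop fun N => coeff m (omegaPartial F N))) := by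
  have hq := one_lt_card (F := F)
  have hq0 : (0 : ℝ) < Fintype.card F := by linarith
  apply CauchySeq.tendsto_limUnder
  apply NonarchimedeanAddGroup.cauchySeq_of_tendsto_sub_nhds_zero
  rw [tendsto_zero_iff_norm_tendsto_zero]
  have hlim : Tendsto (fun N : ℕ => ((Fintype.card F : ℝ)⁻¹) ^ N) atTop (𝓝 0) :=
    tendsto_pow_atTop_nhds_zero_of_lt_one (by positivity) (inv_lt_one_of_one_lt₀ hq)
  refine squeeze_zero (fun _ => norm_nonneg _) (fun N => ?_) hlim
  rw [omegaPartial, Finset.prod_range_succ, ← omegaPartial]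
  refine (norm_coeff_step _ (fun m => (norm_coeff_omegaPartial N m).trans
    (pow_le_one₀ (by positivity) (inv_le_one_of_one_le₀ hq.le))) _ m).trans ?_
  rw [norm_inv, norm_pow, norm_theta, inv_pow]
  refine inv_anti₀ (by positivity) (pow_le_pow_right₀ hq.le ?_)
  exact (Nat.lt_pow_self Fintype.one_lt_card).le.trans
    (Nat.pow_le_pow_right Fintype.card_pos (Nat.le_succ N))

lemma C_mem_tate (c : CInfty F) : C c ∈ tate F := PowerSeries.isRestricted_C 1 c

lemma omega_mem_tate (ϖ : CInfty F) : omega ϖ ∈ tate F := by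
  have hq := one_lt_card (F := F)
  refine (tate F).mul_mem (C_mem_tate _) (mem_tate.2 ?_)
  have hlim : Tendsto (fun N : ℕ => ((Fintype.card F : ℝ)⁻¹) ^ N) atTop (𝓝 0) :=
    tendsto_pow_atTop_nhds_zero_of_lt_one (by positivity) (inv_lt_one_of_one_lt₀ hq)
  refine squeeze_zero (fun _ => norm_nonneg _) (fun m => ?_) hlim
  rw [coeff_mk]
  exact le_of_tendsto' (tendsto_omegaPartial m).norm fun N => norm_coeff_omegaPartial N m

lemma exists_artinSchreier_small (a : CInfty F) (ha : ‖a‖ < 1) :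
    ∃ b : CInfty F, b - b ^ Fintype.card F = a ∧ ‖b‖ ≤ ‖a‖ := by
  let φ := FiniteField.frobeniusAlgHom F (CInfty F)
  have hφ : ∀ x, φ x = x ^ Fintype.card F := fun x => rfl
  have hle : ∀ i : ℕ, ‖a ^ Fintype.card F ^ i‖ ≤ ‖a‖ := fun i => by
    rw [norm_pow]
    exact pow_le_of_le_one (norm_nonneg _) ha.le (pow_ne_zero _ Fintype.card_ne_zero)
  have hs : Summable fun i : ℕ => a ^ Fintype.card F ^ i := by
    apply NonarchimedeanAddGroup.summable_of_tendsto_cofinite_zero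
    rw [Nat.cofinite_eq_atTop]
    exact (tendsto_pow_atTop_nhds_zero_of_norm_lt_one ha).comp
      (tendsto_pow_atTop_atTop_of_one_lt Fintype.one_lt_card)
  refine ⟨∑' i : ℕ, a ^ Fintype.card F ^ i, ?_, ?_⟩
  · have hc : Continuous φ := by
      change Continuous fun x => φ x
      simp only [hφ]
      fun_prop
    have h1 := hs.map_tsum φ hc
    have h2 : ∑' i : ℕ, a ^ Fintype.card F ^ i =
        a ^ Fintype.card F ^ 0 + ∑' i : ℕ, a ^ Fintype.card F ^ (i + 1) := hs.tsum_eq_zero_add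
    simp only [hφ, ← pow_mul, ← pow_succ] at h1
    rw [h1, h2, pow_zero, pow_one, add_sub_cancel_right]
  · exact IsUltrametricDist.norm_tsum_le_of_forall_le_of_nonneg (norm_nonneg _) hle

lemma exists_artinSchreier (a : CInfty F) :
    ∃ b : CInfty F, b - b ^ Fintype.card F = a ∧ (‖a‖ < 1 → ‖b‖ ≤ ‖a‖) := by
  by_cases ha : ‖a‖ < 1
  · obtain ⟨b, hb, hb'⟩ := exists_artinSchreier_small a ha
    exact ⟨b, hb, fun _ => hb'⟩
  obtain ⟨a', ha'⟩ : ∃ a' : KInftyBar F, ‖a - ofBar F a'‖ < 1 := by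
    obtain ⟨y, hy⟩ := (denseRange_ofBar F).exists_dist_lt a one_pos
    exact ⟨y, by rwa [dist_eq_norm] at hy⟩
  obtain ⟨b', hb'⟩ : ∃ b' : KInftyBar F, b' - b' ^ Fintype.card F = a' := by
    have hdeg : (Polynomial.X ^ Fintype.card F - Polynomial.X + Polynomial.C a' :
        Polynomial (KInftyBar F)).natDegree ≠ 0 := by
      rw [Polynomial.natDegree_add_C,
        FiniteField.X_pow_card_sub_X_natDegree_eq _ Fintype.one_lt_card]
      exact Fintype.card_ne_zero
    obtain ⟨b', hb'⟩ := IsAlgClosed.exists_root _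
      (fun h => hdeg (Polynomial.natDegree_eq_of_degree_eq_some h))
    refine ⟨b', ?_⟩
    simp only [Polynomial.IsRoot.def, Polynomial.eval_add, Polynomial.eval_sub,
      Polynomial.eval_pow, Polynomial.eval_X, Polynomial.eval_C] at hb'
    linear_combination -hb'
  obtain ⟨b'', hb'', -⟩ := exists_artinSchreier_small _ ha'
  refine ⟨ofBar F b' + b'', ?_, fun h => absurd h ha⟩
  have hadd : (ofBar F b' + b'') ^ Fintype.card F
      = ofBar F b' ^ Fintype.card F + b'' ^ Fintype.card F :=
    map_add (FiniteField.frobeniusAlgHom F (CInfty F)) _ _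
  have h := congrArg (ofBar F) hb'
  rw [map_sub, map_pow] at h
  rw [hadd]
  linear_combination h + hb''

lemma exists_wp_eq (h : (CInfty F)⟦X⟧) (hh : h ∈ tate F) : ∃ g ∈ tate F, wp g = h := by
  choose b hb hb' using exists_artinSchreier (F := F)
  refine ⟨PowerSeries.mk fun i => b (coeff i h), mem_tate.2 ?_, ?_⟩
  · have h0 := mem_tate.1 hh
    refine squeeze_zero' (Eventually.of_forall fun _ => norm_nonneg _) ?_ h0
    filter_upwards [h0.eventually_lt_const one_pos] with i hi
    rw [coeff_mk]
    exact hb' _ hi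
  · ext i
    simp only [wp, twist, map_sub, coeff_mk, hb]

end aux

/-- `G = (𝔏𝔦^⋆_{0,…,0}(Z_1,…,Z_{d+1}), 𝔏𝔦^⋆_{0,…,0}(Z_2,…,Z_{d+1}), …, 𝔏𝔦^⋆_0(Z_{d+1})) ∈ 𝕋^{d+1}`
is a solution of the system of difference equations
`℘(𝔏𝔦^⋆(Z_j,…,Z_{d+1})) = Z_j · 𝔏𝔦^⋆(Z_{j+1},…,Z_{d+1})`, where the last variable `Z_{d+1}`
is `Y`. -/
def IsStarSolution {F : Type*} [Field F] [Fintype F] {d : ℕ} (Z : Fin d → (CInfty F)⟦X⟧)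
    (Y : (CInfty F)⟦X⟧) (G : Fin (d + 1) → (CInfty F)⟦X⟧) : Prop :=
  (∀ j, G j ∈ tate F) ∧
  (∀ j : Fin d, wp (G j.castSucc) = Z j * G j.succ) ∧
  wp (G (Fin.last d)) = Y

/-- `G = (𝔏𝔦^⋆(Z_1,…,Z_k), 𝔏𝔦^⋆(Z_2,…,Z_k), …, 𝔏𝔦^⋆(Z_k), 1, 0, …, 0) ∈ 𝕋^{d+1}`, whose first
`k` entries solve the system of difference equations attached to `Z_1,…,Z_k`. -/
def IsStarGenerator {F : Type*} [Field F] [Fintype F] {d : ℕ} (Z : Fin d → (CInfty F)⟦X⟧)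
    (k : Fin (d + 1)) (G : Fin (d + 1) → (CInfty F)⟦X⟧) : Prop :=
  (∀ j, G j ∈ tate F) ∧
  (∀ j : Fin d, j.castSucc < k → wp (G j.castSucc) = Z j * G j.succ) ∧
  G k = 1 ∧ ∀ j, k < j → G j = 0

/-- The `𝔽_q[t]`-module `𝕄^{⋆,Z_1,…,Z_d}_{0,…,0} ⊆ 𝕋^{d+1}`, generated by all branches of the
generating vectors. -/
def starModuleZero {F : Type*} [Field F] [Fintype F] {d : ℕ} (Z : Fin d → (CInfty F)⟦X⟧) :
    Submodule (Polynomial F) (Fin (d + 1) → (CInfty F)⟦X⟧) :=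
  Submodule.span (Polynomial F) {G | ∃ k, IsStarGenerator Z k G}

open Pointwise in
/-- The `𝔽_q[t]`-module
`𝕄^{⋆,Z_1,…,Z_d}_{n_1,…,n_{d+1}} = Ω^{-n_1-⋯-n_{d+1}} 𝕄^{⋆,Ω^{n_1}Z_1,…,Ω^{n_d}Z_d}_{0,…,0}`. -/
def starModule {F : Type*} [Field F] [Fintype F] (ϖ : CInfty F) {d : ℕ} (n : Fin (d + 1) → ℕ)
    (Z : Fin d → (CInfty F)⟦X⟧) : Submodule (Polynomial F) (Fin (d + 1) → (CInfty F)⟦X⟧) :=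
  (omega ϖ)⁻¹ ^ (∑ j, n j) • starModuleZero fun j => omega ϖ ^ n j.castSucc * Z j

/-- `G` represents
`𝔏𝔦^⋆_{n_1,…,n_{d+1}}(Z_1,…,Z_d,Y) = Ω^{-n_1-⋯-n_{d+1}} 𝔏𝔦^⋆_{0,…,0}(Ω^{n_1}Z_1,…,Ω^{n_{d+1}}Y)`. -/
def IsStarBranch {F : Type*} [Field F] [Fintype F] (ϖ : CInfty F) {d : ℕ} (n : Fin (d + 1) → ℕ)
    (Z : Fin d → (CInfty F)⟦X⟧) (Y : (CInfty F)⟦X⟧) (G : Fin (d + 1) → (CInfty F)⟦X⟧) : Prop :=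
  ∃ H, IsStarSolution (fun j => omega ϖ ^ n j.castSucc * Z j)
      (omega ϖ ^ n (Fin.last d) * Y) H ∧ G = (omega ϖ)⁻¹ ^ (∑ j, n j) • H

lemma exists_isStarSolution {F : Type*} [Field F] [Fintype F] {d : ℕ}
    (Z : Fin d → (CInfty F)⟦X⟧) (hZ : ∀ j, Z j ∈ tate F) (Y : (CInfty F)⟦X⟧) (hY : Y ∈ tate F) :
    ∃ G, IsStarSolution Z Y G := by
  induction d with
  | zero =>
    obtain ⟨g, hg, h⟩ := exists_wp_eq Y hY
    exact ⟨fun _ => g, fun _ => hg, fun j => j.elim0, h⟩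
  | succ d ih =>
    obtain ⟨G, hG, hG1, hG2⟩ := ih (fun j => Z j.succ) fun j => hZ _
    obtain ⟨g, hg, h⟩ := exists_wp_eq (Z 0 * G 0) ((tate F).mul_mem (hZ 0) (hG 0))
    refine ⟨Fin.cons g G, fun j => ?_, fun j => ?_, ?_⟩
    · cases j using Fin.cases with
      | zero => exact hg
      | succ j => exact hG j
    · cases j using Fin.cases with
      | zero => exact h
      | succ j =>
        rw [← Fin.succ_castSucc, Fin.cons_succ, Fin.cons_succ]
        exact hG1 j
    · rw [← Fin.succ_last, Fin.cons_succ]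
      exact hG2

lemma exists_isStarBranch {F : Type*} [Field F] [Fintype F] (ϖ : CInfty F) {d : ℕ}
    (n : Fin (d + 1) → ℕ) (z : Fin d → CInfty F) (w : CInfty F) :
    ∃ G, IsStarBranch ϖ n (fun j => C (z j)) (C w) G := by
  obtain ⟨H, hH⟩ := exists_isStarSolution (fun j => omega ϖ ^ n j.castSucc * C (z j))
    (fun j => (tate F).mul_mem ((tate F).pow_mem (omega_mem_tate ϖ) _) (C_mem_tate _))
    (omega ϖ ^ n (Fin.last d) * C w)
    ((tate F).mul_mem ((tate F).pow_mem (omega_mem_tate ϖ) _) (C_mem_tate _))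
  exact ⟨_, H, hH, rfl⟩

/-- The ring `A = 𝔽_q[θ]` inside `ℂ_∞`. -/
abbrev ringA (F : Type*) [Field F] [Fintype F] : Subalgebra F (CInfty F) :=
  Algebra.adjoin F {theta F}

/-- The monodromy module `M^{⋆,z_1,…,z_d}_{n_1,…,n_{d+1}} ⊆ ℂ_∞^{d+1}`: the evaluation at `t = θ`
of `𝕄^{⋆,z_1,…,z_d}_{n_1,…,n_{d+1}}`. -/
def monodromy {F : Type*} [Field F] [Fintype F] (ϖ : CInfty F) {d : ℕ} (n : Fin (d + 1) → ℕ)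
    (z : Fin d → CInfty F) : Submodule (ringA F) (Fin (d + 1) → CInfty F) :=
  Submodule.span (ringA F)
    {v | ∃ G ∈ starModule ϖ n fun j => C (z j), ∀ j, v j = evalTheta (G j)}

/-- The continued multiple star polylogarithm
`Li^⋆_{n_1,…,n_{d+1}}(z_1,…,z_d,-) : ℂ_∞ → ℂ_∞^{d+1} / M^{⋆,z_1,…,z_d}_{n_1,…,n_{d+1}}`: the class
of the evaluation at `t = θ` of a branch of `𝔏𝔦^⋆_{n_1,…,n_{d+1}}(z_1,…,z_d,w)`. -/
def liStarCont {F : Type*} [Field F] [Fintype F] (ϖ : CInfty F) {d : ℕ} (n : Fin (d + 1) → ℕ)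
    (z : Fin d → CInfty F) (w : CInfty F) : (Fin (d + 1) → CInfty F) ⧸ monodromy ϖ n z :=
  Submodule.Quotient.mk fun j => evalTheta ((exists_isStarBranch ϖ n z w).choose j)

/-- `L_i = (θ - θ^q) ⋯ (θ - θ^(q^i))`. -/
def carlitzL (F : Type*) [Field F] [Fintype F] (i : ℕ) : CInfty F :=
  ∏ k ∈ Finset.range i, (theta F - theta F ^ Fintype.card F ^ (k + 1))

/-- The series `Li^⋆ = ∑_{i_1 ≤ ⋯ ≤ i_m} ∏_j z_j^(q^(i_j)) / L_{i_j}^(n_j)`, with variables indexed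
by a finite linear order. -/
def liStar {F : Type*} [Field F] [Fintype F] {ι : Type*} [Fintype ι] [LinearOrder ι]
    (n : ι → ℕ) (z : ι → CInfty F) : CInfty F :=
  ∑' i : {i : ι → ℕ // Monotone i},
    ∏ j, z j ^ Fintype.card F ^ i.1 j / carlitzL F (i.1 j) ^ n j

/-- The region `𝔻^⋆`: the tuples `(z_j)` such that
`∏_j |z_j / θ^(q n_j / (q - 1))| ^ (q^(i_j)) → 0` as `i_1 ≤ ⋯ ≤ i_m → ∞`. (The monotone tuples with
bounded last entry are finite in number.) -/
def DStar {F : Type*} [Field F] [Fintype F] {ι : Type*} [Fintype ι] [LinearOrder ι]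
    (n : ι → ℕ) : Set (ι → CInfty F) :=
  {z | Tendsto (fun i : {i : ι → ℕ // Monotone i} =>
      ∏ j, (‖z j‖ / ‖theta F‖ ^ ((Fintype.card F * n j : ℝ) / (Fintype.card F - 1))) ^
        Fintype.card F ^ i.1 j) cofinite (𝓝 0)}

/-- `f` is a rigid-analytic function on the closed disk `{x : |x - x₀| ≤ r}`: it is given there
by a power series in `x - x₀` with coefficients satisfying `|a_m| r^m → 0`. -/
def IsRigidAnalyticOnDisk {E : Type*} [NontriviallyNormedField E] (f : E → E) (x₀ : E) (r : ℝ) :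
    Prop :=
  ∃ a : ℕ → E, Tendsto (fun m => ‖a m‖ * r ^ m) atTop (𝓝 0) ∧
    ∀ x ∈ Metric.closedBall x₀ r, HasSum (fun m => a m * (x - x₀) ^ m) (f x)

/-- `L : ℂ_∞ → ℂ_∞^m / M` is locally rigid-analytic: every point has a closed disk `U` around it
and a closed (poly)disk `V ⊆ ℂ_∞^m` that injects into the quotient such that `L` maps `U` into
the image of `V`, and the induced map `U → V` is rigid-analytic. The radii of the disks lie in
the value group of `ℂ_∞`. -/
def IsLocallyRigidAnalytic {F : Type*} [Field F] [Fintype F] {m : ℕ}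
    {M : Submodule (ringA F) (Fin m → CInfty F)} (L : CInfty F → (Fin m → CInfty F) ⧸ M) : Prop :=
  ∀ x₀ : CInfty F, ∃ (ρ σ : CInfty F) (c : Fin m → CInfty F), ρ ≠ 0 ∧ σ ≠ 0 ∧
    Set.InjOn (Submodule.Quotient.mk (p := M)) (Metric.closedBall c ‖σ‖) ∧
    ∃ f : CInfty F → Fin m → CInfty F,
      Set.MapsTo f (Metric.closedBall x₀ ‖ρ‖) (Metric.closedBall c ‖σ‖) ∧
      (∀ x ∈ Metric.closedBall x₀ ‖ρ‖, L x = Submodule.Quotient.mk (f x)) ∧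
      ∀ j, IsRigidAnalyticOnDisk (fun x => f x j) x₀ ‖ρ‖

end
end CarlitzStar

open CarlitzStar PowerSeries

namespace CarlitzStar
noncomputable section
variable {F : Type*} [Field F] [Fintype F]

/-! ### Series converging on the disk `|t| ≤ |θ|` and evaluation at `θ` -/

/-! All evaluations take place in `thetaTate F`, the series converging on |t| ≤ |θ|. The zeros
θ^(q^i), i ≥ 1, of Ω lie outside this disk, so Ω is a unit there. Moreover |a - a^q| = |a| whenever
|a| < 1, so h ∈ 𝕋 converges on the disk as soon as ℘(h) does (`mem_thetaTate_of_wp`); hence every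
branch can be evaluated at θ. Two branches for the same argument differ by a solution of the
homogeneous system. The kernel of ℘ on 𝕋 is 𝔽_q[t], and eliminating coordinates from the last to the
first shows that these solutions are exactly 𝕄_0 (`mem_starModuleZero_of_isStarSolution`). This
gives independence of the branch; linearity follows by adding and scaling solutions.

For (1), consider the sum over i_1 ≤ ⋯ ≤ i_m of the products of the i_j-fold twists of Ω^(n_j) z_j.
Tuples with i_1 ≥ 1 sum to the twist of the series, and tuples with i_1 = 0 to Ω^(n_1) z_1 times the
series of the tail, so ℘ acts as required (`wp_starSeries`) and the series of the tails form a
branch. The relation Ω = (t - θ^q) Ω^(1) makes the i-fold twist of Ω take the value Ω(θ)/L_i at θ,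
which turns the series into Li^⋆ up to a power of Ω(θ) (`evalTheta_starSeries`).

For (2), a nonzero p ∈ 𝔽_q[t] has |p(θ)| ≥ 1, so nonzero elements of M^⋆ have norm at least |π̃^N|
(`eq_zero_of_mem_monodromy`). For small arguments all tails converge and Li^⋆ is a power series in
the last variable; linearity transports this to every centre x₀. -/

lemma theta_ne_zero : theta F ≠ 0 := by
  rw [← norm_ne_zero_iff, norm_theta]
  exact_mod_cast Fintype.card_ne_zero

/-! ### Summation and Cauchy products over an ultrametric field. -/

section nonarchimedean
variable {E : Type*} [NormedField E] [IsUltrametricDist E]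

instance nonarchimedeanRing_of_ultrametric : NonarchimedeanRing E where
  is_nonarchimedean := NonarchimedeanAddGroup.is_nonarchimedean

lemma summable_iff_tendsto_norm [CompleteSpace E] {α : Type*} {f : α → E} :
    Summable f ↔ Tendsto (fun a => ‖f a‖) cofinite (𝓝 0) := by
  rw [NonarchimedeanAddGroup.summable_iff_tendsto_cofinite_zero,
    tendsto_zero_iff_norm_tendsto_zero]

lemma tsum_mul_tsum_antidiagonal {a b : ℕ → E} (ha : Summable a) (hb : Summable b) :
    (∑' i, a i) * ∑' i, b i = ∑' m, ∑ p ∈ Finset.HasAntidiagonal.antidiagonal m, a p.1 * b p.2 :=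
  ha.tsum_mul_tsum_eq_tsum_sum_antidiagonal hb (Summable.mul_of_nonarchimedean (R := E) ha hb)

lemma tsum_coeff_mul_pow {f g : E⟦X⟧} {x : E} (hf : Summable fun i => coeff i f * x ^ i)
    (hg : Summable fun i => coeff i g * x ^ i) :
    ∑' i, coeff i (f * g) * x ^ i = (∑' i, coeff i f * x ^ i) * ∑' i, coeff i g * x ^ i := by
  rw [tsum_mul_tsum_antidiagonal hf hg]
  refine tsum_congr fun m => ?_
  rw [coeff_mul, Finset.sum_mul]
  refine Finset.sum_congr rfl fun p hp => ?_
  rw [← Finset.HasAntidiagonal.mem_antidiagonal.1 hp, pow_add]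
  ring

end nonarchimedean

/-- The power series over `ℂ_∞` converging on the disk `|t| ≤ |θ|`. -/
def thetaTate (F : Type*) [Field F] [Fintype F] : Subring (CInfty F)⟦X⟧ :=
  PowerSeries.IsRestricted.subring (Fintype.card F : ℝ)

lemma mem_thetaTate_iff_tendsto {f : (CInfty F)⟦X⟧} :
    f ∈ thetaTate F ↔
      Tendsto (fun i => ‖coeff i f‖ * (Fintype.card F : ℝ) ^ i) atTop (𝓝 0) := by
  have h : f ∈ thetaTate F ↔ PowerSeries.IsRestricted (Fintype.card F : ℝ) f := Iff.rfl
  rw [h, PowerSeries.isRestricted_iff']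

lemma mem_thetaTate {f : (CInfty F)⟦X⟧} :
    f ∈ thetaTate F ↔ Summable fun i => coeff i f * theta F ^ i := by
  rw [mem_thetaTate_iff_tendsto, summable_iff_tendsto_norm, Nat.cofinite_eq_atTop]
  simp only [norm_mul, norm_pow, norm_theta]

lemma C_mem_thetaTate (c : CInfty F) : C c ∈ thetaTate F := PowerSeries.isRestricted_C _ c

lemma X_mem_thetaTate : X ∈ thetaTate F := PowerSeries.isRestricted_monomial _ 1 1

lemma evalTheta_add {f g : (CInfty F)⟦X⟧} (hf : f ∈ thetaTate F) (hg : g ∈ thetaTate F) :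
    evalTheta (f + g) = evalTheta f + evalTheta g := by
  simp only [evalTheta, map_add, add_mul]
  exact (mem_thetaTate.1 hf).tsum_add (mem_thetaTate.1 hg)

lemma evalTheta_mul {f g : (CInfty F)⟦X⟧} (hf : f ∈ thetaTate F) (hg : g ∈ thetaTate F) :
    evalTheta (f * g) = evalTheta f * evalTheta g :=
  tsum_coeff_mul_pow (mem_thetaTate.1 hf) (mem_thetaTate.1 hg)

lemma evalTheta_C (c : CInfty F) : evalTheta (C c) = c := by
  rw [evalTheta, tsum_eq_single 0 fun i hi => by simp [coeff_C, hi]]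
  simp

lemma evalTheta_X : evalTheta (X : (CInfty F)⟦X⟧) = theta F := by
  rw [evalTheta, tsum_eq_single 1 fun i hi => by simp [coeff_X, hi]]
  simp

lemma evalTheta_one : evalTheta (1 : (CInfty F)⟦X⟧) = 1 := by
  rw [← evalTheta_C (F := F) 1, map_one]

lemma evalTheta_sub {f g : (CInfty F)⟦X⟧} (hf : f ∈ thetaTate F) (hg : g ∈ thetaTate F) :
    evalTheta (f - g) = evalTheta f - evalTheta g := by
  rw [eq_sub_iff_add_eq, ← evalTheta_add ((thetaTate F).sub_mem hf hg) hg, sub_add_cancel]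

lemma evalTheta_pow {f : (CInfty F)⟦X⟧} (hf : f ∈ thetaTate F) (m : ℕ) :
    evalTheta (f ^ m) = evalTheta f ^ m := by
  induction m with
  | zero => rw [pow_zero, pow_zero, evalTheta_one]
  | succ m ih => rw [pow_succ, pow_succ, evalTheta_mul ((thetaTate F).pow_mem hf m) hf, ih]

lemma evalTheta_prod {ι : Type*} (s : Finset ι) {f : ι → (CInfty F)⟦X⟧}
    (hf : ∀ i, f i ∈ thetaTate F) :
    evalTheta (∏ i ∈ s, f i) = ∏ i ∈ s, evalTheta (f i) := by
  classical
  induction s using Finset.induction_on with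
  | empty => rw [Finset.prod_empty, Finset.prod_empty, evalTheta_one]
  | insert i s hi ih =>
    rw [Finset.prod_insert hi, Finset.prod_insert hi,
      evalTheta_mul (hf i) ((thetaTate F).prod_mem fun j _ => hf j), ih]

/-! ### Frobenius twists -/

/-- The Frobenius twist as a ring homomorphism. -/
def twistHom (F : Type*) [Field F] [Fintype F] : (CInfty F)⟦X⟧ →+* (CInfty F)⟦X⟧ :=
  PowerSeries.map (FiniteField.frobeniusAlgHom F (CInfty F)).toRingHom

lemma twistHom_apply (f : (CInfty F)⟦X⟧) : twistHom F f = twist f := by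
  ext i
  rw [twistHom, coeff_map, twist, coeff_mk]
  rfl

lemma coeff_twist (f : (CInfty F)⟦X⟧) (i : ℕ) :
    coeff i (twist f) = coeff i f ^ Fintype.card F := coeff_mk _ _

lemma twist_add (f g : (CInfty F)⟦X⟧) : twist (f + g) = twist f + twist g := by
  simp only [← twistHom_apply, map_add]

lemma twist_sub (f g : (CInfty F)⟦X⟧) : twist (f - g) = twist f - twist g := by
  simp only [← twistHom_apply, map_sub]

lemma twist_mul (f g : (CInfty F)⟦X⟧) : twist (f * g) = twist f * twist g := by
  simp only [← twistHom_apply, map_mul]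

lemma twist_C (c : CInfty F) : twist (C c) = C (c ^ Fintype.card F) := by
  rw [← twistHom_apply, twistHom, map_C]; rfl

lemma twist_X : twist (X : (CInfty F)⟦X⟧) = X := by
  rw [← twistHom_apply, twistHom, map_X]

lemma twist_one : twist (1 : (CInfty F)⟦X⟧) = 1 := by
  rw [← twistHom_apply, map_one]

lemma wp_add (f g : (CInfty F)⟦X⟧) : wp (f + g) = wp f + wp g := by
  simp only [wp, twist_add]; ring

lemma wp_sub (f g : (CInfty F)⟦X⟧) : wp (f - g) = wp f - wp g := by
  simp only [wp, twist_sub]; ring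

lemma wp_zero : wp (0 : (CInfty F)⟦X⟧) = 0 := by
  rw [wp, ← twistHom_apply, map_zero, sub_zero]

lemma wp_one : wp (1 : (CInfty F)⟦X⟧) = 0 := by
  rw [wp, twist_one, sub_self]

lemma wp_mul_of_twist_eq {a f : (CInfty F)⟦X⟧} (ha : twist a = a) : wp (a * f) = a * wp f := by
  rw [wp, wp, twist_mul, ha]; ring

/-- All but finitely many coefficients a of h satisfy |a| < 1, and then |a - a^q| = |a|: the
coefficients of h and of ℘(h) eventually have the same size. -/
lemma mem_thetaTate_of_wp {h : (CInfty F)⟦X⟧} (hh : h ∈ tate F) (hw : wp h ∈ thetaTate F) :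
    h ∈ thetaTate F := by
  rw [mem_thetaTate_iff_tendsto] at hw ⊢
  refine hw.congr' ?_
  filter_upwards [(mem_tate.1 hh).eventually_lt_const one_pos] with i hi
  congr 1
  rw [wp, map_sub, coeff_twist]
  rcases eq_or_ne (coeff i h) 0 with h0 | h0
  · rw [h0, zero_pow Fintype.card_ne_zero, sub_zero]
  · have hlt : ‖coeff i h ^ Fintype.card F‖ < ‖coeff i h‖ := by
      rw [norm_pow]
      exact pow_lt_self_of_lt_one₀ (norm_pos_iff.2 h0) hi Fintype.one_lt_card
    rw [sub_eq_add_neg, IsUltrametricDist.norm_add_eq_max_of_norm_ne_norm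
      (by rw [norm_neg]; exact hlt.ne'), norm_neg, max_eq_left hlt.le]

/-! ### The coefficient ring `𝔽_q[t]` -/

/-- A polynomial over `𝔽_q` as a power series over `ℂ_∞`. -/
def polyToSeries (p : Polynomial F) : (CInfty F)⟦X⟧ := algebraMap (Polynomial F) (CInfty F)⟦X⟧ p

lemma coeff_polyToSeries (p : Polynomial F) (i : ℕ) :
    coeff i (polyToSeries p) = algebraMap F (CInfty F) (p.coeff i) := by
  rw [polyToSeries, algebraMap_apply', coeff_map, Polynomial.coeff_coe]

lemma smul_eq_polyToSeries_mul (p : Polynomial F) (f : (CInfty F)⟦X⟧) :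
    p • f = polyToSeries p * f := Algebra.smul_def p f

lemma twist_polyToSeries (p : Polynomial F) : twist (polyToSeries p) = polyToSeries p := by
  ext i
  rw [coeff_twist, coeff_polyToSeries, ← map_pow, FiniteField.pow_card]

lemma polyToSeries_mem_tate (p : Polynomial F) : polyToSeries p ∈ tate F := by
  rw [mem_tate]
  refine tendsto_const_nhds.congr' ?_
  filter_upwards [eventually_gt_atTop p.natDegree] with i hi
  rw [coeff_polyToSeries, Polynomial.coeff_eq_zero_of_natDegree_lt hi]
  simp

/-- The polynomial X^q - X splits over 𝔽_q as the product of all X - a, so it has no further roots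
in ℂ_∞. -/
lemma exists_algebraMap_of_pow_card_eq {x : CInfty F} (hx : x - x ^ Fintype.card F = 0) :
    ∃ a : F, algebraMap F (CInfty F) a = x := by
  have h1 : ∏ a : F, (Polynomial.X - Polynomial.C a)
      = Polynomial.X ^ Fintype.card F - Polynomial.X := by
    have h := Polynomial.prod_multiset_X_sub_C_of_monic_of_roots_card_eq
      (p := (Polynomial.X ^ Fintype.card F - Polynomial.X : Polynomial F))
      (Polynomial.monic_X_pow_sub (by
        rw [Polynomial.degree_X]; exact_mod_cast Fintype.one_lt_card))
      (by
        rw [FiniteField.roots_X_pow_card_sub_X,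
          FiniteField.X_pow_card_sub_X_natDegree_eq _ Fintype.one_lt_card]
        rfl)
    rwa [FiniteField.roots_X_pow_card_sub_X] at h
  have h2 := congrArg (Polynomial.eval₂ (algebraMap F (CInfty F)) x) h1
  rw [Polynomial.eval₂_finsetProd] at h2
  simp only [Polynomial.eval₂_sub, Polynomial.eval₂_X, Polynomial.eval₂_C, Polynomial.eval₂_X_pow]
    at h2
  rw [← neg_sub x, hx, neg_zero, Finset.prod_eq_zero_iff] at h2
  obtain ⟨a, -, ha⟩ := h2
  exact ⟨a, (sub_eq_zero.1 ha).symm⟩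

lemma norm_algebraMap {a : F} (ha : a ≠ 0) : ‖algebraMap F (CInfty F) a‖ = 1 := by
  refine (norm_ofRatFunc F (RatFunc.C a)).trans ?_
  simp [inftyAbs, ha]

/-- The coefficients lie in 𝔽_q, whose nonzero elements have absolute value 1; since they tend to 0,
almost all of them vanish. -/
lemma exists_polyToSeries_of_wp_eq_zero {f : (CInfty F)⟦X⟧} (hf : f ∈ tate F) (h : wp f = 0) :
    ∃ p : Polynomial F, polyToSeries p = f := by
  choose a ha using fun i => exists_algebraMap_of_pow_card_eq (F := F) (x := coeff i f) (by
    rw [← coeff_twist, ← map_sub]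
    exact congrArg (coeff i) h)
  obtain ⟨N, hN⟩ := eventually_atTop.1 ((mem_tate.1 hf).eventually_lt_const one_pos)
  have h0 : ∀ i, N ≤ i → a i = 0 := fun i hi => by
    by_contra hne
    have h1 := hN i hi
    rw [← ha, norm_algebraMap hne] at h1
    exact lt_irrefl _ h1
  refine ⟨∑ i ∈ Finset.range N, Polynomial.monomial i (a i), ?_⟩
  ext i
  rw [coeff_polyToSeries, ← ha, Polynomial.finsetSum_coeff]
  simp only [Polynomial.coeff_monomial, Finset.sum_ite_eq', Finset.mem_range]
  split_ifs with hi
  · rfl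
  · rw [h0 i (not_lt.1 hi)]

lemma evalTheta_polyToSeries (p : Polynomial F) :
    evalTheta (polyToSeries p) = ofRatFunc F (algebraMap (Polynomial F) (RatFunc F) p) := by
  have hp : ∀ i ∉ Finset.range (p.natDegree + 1),
      coeff i (polyToSeries p) * theta F ^ i = 0 := fun i hi => by
    rw [coeff_polyToSeries, Polynomial.coeff_eq_zero_of_natDegree_lt (by simpa using hi)]
    simp
  rw [evalTheta, tsum_eq_sum hp]
  conv_rhs => rw [Polynomial.as_sum_range_C_mul_X_pow p]
  rw [map_sum, map_sum]
  refine Finset.sum_congr rfl fun i _ => ?_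
  rw [map_mul, map_mul, map_pow, map_pow, RatFunc.algebraMap_X, RatFunc.algebraMap_C,
    coeff_polyToSeries]
  rfl

/-- |p(θ)| = q^(deg p). This discreteness of A is what makes the monodromy module discrete. -/
lemma one_le_norm_evalTheta_polyToSeries {p : Polynomial F} (hp : p ≠ 0) :
    1 ≤ ‖evalTheta (polyToSeries p)‖ := by
  rw [evalTheta_polyToSeries]
  refine le_of_le_of_eq ?_ (norm_ofRatFunc F _).symm
  have h : algebraMap (Polynomial F) (RatFunc F) p ≠ 0 := by simpa using hp
  classical
  change 1 ≤ (if algebraMap (Polynomial F) (RatFunc F) p = 0 then (0 : ℝ) else _)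
  rw [if_neg h, RatFunc.intDegree_polynomial, zpow_natCast]
  exact one_le_pow₀ one_lt_card.le

lemma polyToSeries_mem_thetaTate (p : Polynomial F) : polyToSeries p ∈ thetaTate F := by
  refine mem_thetaTate_of_wp (polyToSeries_mem_tate p) ?_
  rw [wp, twist_polyToSeries, sub_self]
  exact (thetaTate F).zero_mem

/-! ### Geometric bounds on coefficients -/

/-- The coefficients of `f` satisfy `|a_m| ≤ B s ^ m`. -/
def CoeffBound {E : Type*} [NormedField E] (B s : ℝ) (f : E⟦X⟧) : Prop :=
  ∀ m, ‖coeff m f‖ ≤ B * s ^ m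

namespace CoeffBound
section
variable {E : Type*} [NormedField E] {B B' s : ℝ} {f g : E⟦X⟧}

lemma C (hs : 0 ≤ s) (c : E) : CoeffBound ‖c‖ s (PowerSeries.C c) := fun m => by
  rw [coeff_C]
  split_ifs with h
  · simp [h]
  · rw [norm_zero]; positivity

lemma one (hs : 0 ≤ s) : CoeffBound 1 s (1 : E⟦X⟧) := by
  have h := CoeffBound.C hs (1 : E)
  rwa [norm_one, map_one] at h

lemma one_sub_C_mul_X (hs : 0 ≤ s) {c : E} (hc : ‖c‖ ≤ s) :
    CoeffBound 1 s (1 - PowerSeries.C c * X) := fun m => by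
  rw [map_sub, coeff_C_mul, coeff_one, coeff_X]
  rcases m with _ | _ | m
  · simp
  · simpa using hc
  · simp only [Nat.add_eq_zero_iff, one_ne_zero, and_false, if_false, one_mul]
    simp
    positivity

variable [IsUltrametricDist E]

lemma mul (hs : 0 ≤ s) (hf : CoeffBound B s f) (hg : CoeffBound B' s g) :
    CoeffBound (B * B') s (f * g) := fun m => by
  have hB : 0 ≤ B := (norm_nonneg _).trans (by simpa using hf 0)
  have hB' : 0 ≤ B' := (norm_nonneg _).trans (by simpa using hg 0)
  rw [coeff_mul]
  refine IsUltrametricDist.norm_sum_le_of_forall_le_of_nonneg (by positivity) fun p hp => ?_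
  rw [norm_mul, ← Finset.HasAntidiagonal.mem_antidiagonal.1 hp, pow_add]
  calc _ ≤ (B * s ^ p.1) * (B' * s ^ p.2) := by
        gcongr
        exacts [hf _, hg _]
    _ = _ := by ring

lemma pow (hs : 0 ≤ s) (hf : CoeffBound B s f) (m : ℕ) : CoeffBound (B ^ m) s (f ^ m) := by
  induction m with
  | zero => simpa using one hs
  | succ m ih => rw [pow_succ, pow_succ]; exact ih.mul hs hf

lemma prod (hs : 0 ≤ s) {ι : Type*} (t : Finset ι) {b : ι → ℝ} {h : ι → E⟦X⟧}
    (hh : ∀ i, CoeffBound (b i) s (h i)) : CoeffBound (∏ i ∈ t, b i) s (∏ i ∈ t, h i) := by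
  classical
  induction t using Finset.induction_on with
  | empty => simpa using one hs
  | insert i t hi ih =>
    rw [Finset.prod_insert hi, Finset.prod_insert hi]
    exact (hh i).mul hs ih

/-- In the recursion for the m-th coefficient of f⁻¹ every product is bounded by s^m, and the
ultrametric inequality keeps this bound for the sum; the normalised constant term removes the
division. -/
lemma inv (hs : 0 ≤ s) (hf : CoeffBound 1 s f) (h0 : constantCoeff f = 1) :
    CoeffBound 1 s f⁻¹ := fun m => by
  induction m using Nat.strong_induction_on with
  | _ m ih =>
    rw [PowerSeries.coeff_inv]
    split_ifs with hm
    · simp [hm, h0]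
    · rw [h0, inv_one, norm_mul, norm_neg, norm_one, one_mul]
      refine IsUltrametricDist.norm_sum_le_of_forall_le_of_nonneg (by positivity) fun p hp => ?_
      split_ifs with hlt
      · rw [norm_mul, ← Finset.HasAntidiagonal.mem_antidiagonal.1 hp, pow_add, one_mul]
        have h1 := hf p.1
        have h2 := ih p.2 hlt
        rw [one_mul] at h1 h2
        gcongr
      · rw [norm_zero]; positivity

end

variable {B s : ℝ} {f : (CInfty F)⟦X⟧}

/-- The twist decays at the better rate s^q. It is weakened to s, using s ≤ 1, so that one rate
serves all iterated twists. -/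
lemma twist (hs : 0 ≤ s) (hs1 : s ≤ 1) (hf : CoeffBound B s f) :
    CoeffBound (B ^ Fintype.card F) s (twist f) := fun m => by
  have hB : 0 ≤ B := (norm_nonneg _).trans (by simpa using hf 0)
  rw [coeff_twist, norm_pow]
  refine (pow_le_pow_left₀ (norm_nonneg _) (hf m) _).trans ?_
  rw [mul_pow]
  gcongr
  exact pow_le_of_le_one (by positivity) (pow_le_one₀ hs hs1) Fintype.card_ne_zero

lemma iterate_twist (hs : 0 ≤ s) (hs1 : s ≤ 1) (hf : CoeffBound B s f) (i : ℕ) :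
    CoeffBound (B ^ Fintype.card F ^ i) s (CarlitzStar.twist^[i] f) := by
  induction i with
  | zero => simpa using hf
  | succ i ih =>
    rw [Function.iterate_succ_apply', pow_succ, pow_mul]
    exact ih.twist hs hs1

end CoeffBound

/-- The rate of decay `|θ|^(-2)` shared by the coefficients of `Ω` and its twists. -/
def decay (F : Type*) [Fintype F] : ℝ := ((Fintype.card F : ℝ) ^ 2)⁻¹

lemma decay_nonneg : 0 ≤ decay F := by unfold decay; positivity

lemma decay_mul_card : decay F * Fintype.card F = (Fintype.card F : ℝ)⁻¹ := by
  have : (Fintype.card F : ℝ) ≠ 0 := by simp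
  unfold decay; field_simp

lemma inv_card_lt_one : (Fintype.card F : ℝ)⁻¹ < 1 := inv_lt_one_of_one_lt₀ one_lt_card

lemma decay_le_one : decay F ≤ 1 := by
  unfold decay
  exact inv_le_one_of_one_le₀ (one_le_pow₀ one_lt_card.le)

lemma tendsto_inv_card_pow :
    Tendsto (fun m : ℕ => ((Fintype.card F : ℝ)⁻¹) ^ m) atTop (𝓝 0) :=
  tendsto_pow_atTop_nhds_zero_of_lt_one (by positivity) inv_card_lt_one

lemma CoeffBound.norm_mul_theta_pow_le {B : ℝ} {f : (CInfty F)⟦X⟧} (hf : CoeffBound B (decay F) f)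
    (m : ℕ) : ‖coeff m f * theta F ^ m‖ ≤ B * ((Fintype.card F : ℝ)⁻¹) ^ m := by
  rw [norm_mul, norm_pow, norm_theta, ← decay_mul_card, mul_pow, ← mul_assoc]
  gcongr
  exact hf m

lemma CoeffBound.mem_thetaTate {B : ℝ} {f : (CInfty F)⟦X⟧} (hf : CoeffBound B (decay F) f) :
    f ∈ thetaTate F := by
  rw [CarlitzStar.mem_thetaTate, summable_iff_tendsto_norm, Nat.cofinite_eq_atTop]
  refine squeeze_zero (fun _ => norm_nonneg _) hf.norm_mul_theta_pow_le ?_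
  simpa using tendsto_inv_card_pow.const_mul B

lemma thetaTate_le_tate : thetaTate F ≤ tate F := fun f hf => by
  rw [mem_thetaTate_iff_tendsto] at hf
  rw [mem_tate]
  refine squeeze_zero (fun _ => norm_nonneg _) (fun i => ?_) hf
  exact le_mul_of_one_le_right (norm_nonneg _) (one_le_pow₀ one_lt_card.le)

/-! ### The series `Ω` -/

/-- The product `∏_{i ≥ 1} (1 - t / θ^(q^i))`. -/
def omegaProd (F : Type*) [Field F] [Fintype F] : (CInfty F)⟦X⟧ :=
  PowerSeries.mk fun m => limUnder atTop fun N => coeff m (omegaPartial F N)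

lemma omega_eq (ϖ : CInfty F) : omega ϖ = C ((ϖ ^ Fintype.card F)⁻¹) * omegaProd F := rfl

lemma tendsto_coeff_omegaPartial (m : ℕ) :
    Tendsto (fun N => coeff m (omegaPartial F N)) atTop (𝓝 (coeff m (omegaProd F))) := by
  rw [omegaProd, coeff_mk]
  exact tendsto_omegaPartial m

/-- The product starts at θ^q, so every factor has linear coefficient of size at most |θ|^(-q) ≤
|θ|^(-2). On |t| = |θ| this still leaves geometric decay with ratio |θ|^(-1). -/
lemma coeffBound_omegaPartial (N : ℕ) : CoeffBound 1 (decay F) (omegaPartial F N) := by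
  have h : ∀ i : ℕ, CoeffBound 1 (decay F)
      (1 - C ((theta F ^ Fintype.card F ^ (i + 1))⁻¹) * X) := fun i => by
    refine CoeffBound.one_sub_C_mul_X decay_nonneg ?_
    rw [norm_inv, norm_pow, norm_theta, decay]
    refine inv_anti₀ (by positivity) (pow_le_pow_right₀ one_lt_card.le ?_)
    calc 2 ≤ Fintype.card F := Fintype.one_lt_card
      _ ≤ _ := Nat.le_self_pow (Nat.succ_ne_zero i) _
  have h2 := CoeffBound.prod decay_nonneg (Finset.range N) h
  rwa [Finset.prod_const_one] at h2

lemma coeffBound_omegaProd : CoeffBound 1 (decay F) (omegaProd F) := fun m =>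
  le_of_tendsto' (tendsto_coeff_omegaPartial m).norm fun N => coeffBound_omegaPartial N m

lemma constantCoeff_omegaProd : constantCoeff (omegaProd F) = 1 := by
  rw [← coeff_zero_eq_constantCoeff_apply]
  refine tendsto_nhds_unique (tendsto_coeff_omegaPartial 0) ?_
  refine tendsto_const_nhds.congr fun N => ?_
  rw [coeff_zero_eq_constantCoeff_apply, omegaPartial, map_prod]
  simp

lemma omegaPartial_succ (N : ℕ) : omegaPartial F (N + 1) =
    (1 - C ((theta F ^ Fintype.card F)⁻¹) * X) * twist (omegaPartial F N) := by
  rw [omegaPartial, Finset.prod_range_succ', zero_add, pow_one, mul_comm, omegaPartial,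
    ← twistHom_apply, map_prod]
  congr 1
  refine Finset.prod_congr rfl fun i _ => ?_
  rw [map_sub, map_one, map_mul, twistHom_apply, twistHom_apply, twist_C, twist_X, inv_pow,
    ← pow_mul, ← pow_succ]

lemma coeff_one_sub_C_mul_X_mul (c : CInfty F) (f : (CInfty F)⟦X⟧) (m : ℕ) :
    coeff m ((1 - C c * X) * f) = coeff m f - c * coeff m (f * X) := by
  have h : (1 - C c * X) * f = f - C c * (f * X) := by ring
  rw [h, map_sub, coeff_C_mul]

/-- Twisting shifts the factors by one, so a partial product is its first factor times a twisted
shorter one; the identity passes to the limit in each coefficient. -/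
lemma omegaProd_eq : omegaProd F =
    (1 - C ((theta F ^ Fintype.card F)⁻¹) * X) * twist (omegaProd F) := by
  ext m
  have h1 := (tendsto_coeff_omegaPartial (F := F) m).comp (tendsto_add_atTop_nat 1)
  refine tendsto_nhds_unique h1 ?_
  simp only [Function.comp_def, omegaPartial_succ, coeff_one_sub_C_mul_X_mul]
  refine Tendsto.sub ?_ (Tendsto.const_mul _ ?_)
  · simp only [coeff_twist]
    exact (tendsto_coeff_omegaPartial m).pow _
  · cases m with
    | zero => simp
    | succ m =>
      simp only [coeff_succ_mul_X, coeff_twist]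
      exact (tendsto_coeff_omegaPartial m).pow _

lemma period_ne_zero {ϖ : CInfty F} (hϖ : ϖ ^ (Fintype.card F - 1) = -theta F) : ϖ ≠ 0 := by
  rintro rfl
  have h : Fintype.card F - 1 ≠ 0 := (Nat.sub_pos_of_lt Fintype.one_lt_card).ne'
  rw [zero_pow h] at hϖ
  exact theta_ne_zero (neg_eq_zero.1 hϖ.symm)

lemma neg_pow_card (x : CInfty F) : (-x) ^ Fintype.card F = -x ^ Fintype.card F :=
  map_neg (FiniteField.frobeniusAlgHom F (CInfty F)) x

lemma period_pow_card_pow_card {ϖ : CInfty F} (hϖ : ϖ ^ (Fintype.card F - 1) = -theta F) :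
    (ϖ ^ Fintype.card F) ^ Fintype.card F = -theta F ^ Fintype.card F * ϖ ^ Fintype.card F := by
  rw [← neg_pow_card, ← hϖ, ← mul_pow]
  congr 1
  rw [← pow_succ, Nat.sub_add_cancel Fintype.card_pos]

/-- The prefactor ϖ^(-q) is chosen so that its own twist supplies the factor -θ^q missing between 1
- t/θ^q and t - θ^q. -/
lemma omega_eq_mul_twist {ϖ : CInfty F} (hϖ : ϖ ^ (Fintype.card F - 1) = -theta F) :
    omega ϖ = (X - C (theta F ^ Fintype.card F)) * twist (omega ϖ) := by
  have hu : ϖ ^ Fintype.card F ≠ 0 := pow_ne_zero _ (period_ne_zero hϖ)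
  have ht : theta F ^ Fintype.card F ≠ 0 := pow_ne_zero _ theta_ne_zero
  have h1 : C ((ϖ ^ Fintype.card F)⁻¹) = C (-theta F ^ Fintype.card F) *
      (C ((ϖ ^ Fintype.card F)⁻¹ ^ Fintype.card F) : (CInfty F)⟦X⟧) := by
    rw [← map_mul, inv_pow, period_pow_card_pow_card hϖ]
    congr 1
    field_simp
  have h2 : X - C (theta F ^ Fintype.card F) = C (-theta F ^ Fintype.card F) *
      (1 - C ((theta F ^ Fintype.card F)⁻¹) * X : (CInfty F)⟦X⟧) := by
    rw [mul_sub, ← mul_assoc, ← map_mul, neg_mul, mul_inv_cancel₀ ht]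
    simp only [map_neg, map_one]
    ring
  rw [omega_eq, twist_mul, twist_C, h1, h2]
  conv_lhs => rw [omegaProd_eq]
  ring

lemma coeffBound_omega (ϖ : CInfty F) :
    CoeffBound (‖ϖ‖ ^ Fintype.card F)⁻¹ (decay F) (omega ϖ) := by
  have h := (CoeffBound.C decay_nonneg ((ϖ ^ Fintype.card F)⁻¹)).mul decay_nonneg
    (coeffBound_omegaProd (F := F))
  rwa [mul_one, norm_inv, norm_pow] at h

lemma omega_mem_thetaTate (ϖ : CInfty F) : omega ϖ ∈ thetaTate F :=
  (coeffBound_omega ϖ).mem_thetaTate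

lemma constantCoeff_omega (ϖ : CInfty F) :
    constantCoeff (omega ϖ) = (ϖ ^ Fintype.card F)⁻¹ := by
  rw [omega_eq, map_mul, constantCoeff_omegaProd, mul_one, constantCoeff_C]

/-- The infinite product has constant term 1 and geometric decay, so its inverse decays at the same
rate. -/
lemma omega_inv_mem_thetaTate (ϖ : CInfty F) : (omega ϖ)⁻¹ ∈ thetaTate F := by
  have h : (omega ϖ)⁻¹ = C (ϖ ^ Fintype.card F) * (omegaProd F)⁻¹ := by
    rw [omega_eq, PowerSeries.mul_inv_rev, mul_comm, PowerSeries.C_inv, inv_inv]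
  rw [h]
  exact (thetaTate F).mul_mem (C_mem_thetaTate _)
    (coeffBound_omegaProd.inv decay_nonneg constantCoeff_omegaProd).mem_thetaTate

lemma omega_mul_inv {ϖ : CInfty F} (hϖ : ϖ ^ (Fintype.card F - 1) = -theta F) :
    omega ϖ * (omega ϖ)⁻¹ = 1 := by
  refine PowerSeries.mul_inv_cancel _ ?_
  rw [constantCoeff_omega]
  exact inv_ne_zero (pow_ne_zero _ (period_ne_zero hϖ))

lemma evalTheta_omega_mul_evalTheta_inv {ϖ : CInfty F}
    (hϖ : ϖ ^ (Fintype.card F - 1) = -theta F) :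
    evalTheta (omega ϖ) * evalTheta (omega ϖ)⁻¹ = 1 := by
  rw [← evalTheta_mul (omega_mem_thetaTate ϖ) (omega_inv_mem_thetaTate ϖ), omega_mul_inv hϖ,
    evalTheta_one]

lemma evalTheta_omega_ne_zero {ϖ : CInfty F} (hϖ : ϖ ^ (Fintype.card F - 1) = -theta F) :
    evalTheta (omega ϖ) ≠ 0 :=
  left_ne_zero_of_mul_eq_one (evalTheta_omega_mul_evalTheta_inv hϖ)

lemma evalTheta_omega_inv {ϖ : CInfty F} (hϖ : ϖ ^ (Fintype.card F - 1) = -theta F) :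
    evalTheta (omega ϖ)⁻¹ = piTilde ϖ := by
  rw [piTilde, eq_div_iff (evalTheta_omega_ne_zero hϖ), mul_comm]
  exact evalTheta_omega_mul_evalTheta_inv hϖ

lemma piTilde_ne_zero {ϖ : CInfty F} (hϖ : ϖ ^ (Fintype.card F - 1) = -theta F) :
    piTilde ϖ ≠ 0 :=
  div_ne_zero one_ne_zero (evalTheta_omega_ne_zero hϖ)

lemma coeffBound_iterate_twist_omega (ϖ : CInfty F) (i : ℕ) :
    CoeffBound ((‖ϖ‖ ^ Fintype.card F)⁻¹ ^ Fintype.card F ^ i) (decay F) (twist^[i] (omega ϖ)) :=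
  (coeffBound_omega ϖ).iterate_twist decay_nonneg decay_le_one i

lemma iterate_twist_omega {ϖ : CInfty F} (hϖ : ϖ ^ (Fintype.card F - 1) = -theta F) (i : ℕ) :
    twist^[i] (omega ϖ) =
      (X - C (theta F ^ Fintype.card F ^ (i + 1))) * twist^[i + 1] (omega ϖ) := by
  induction i with
  | zero =>
    rw [zero_add, pow_one]
    exact omega_eq_mul_twist hϖ
  | succ i ih =>
    rw [Function.iterate_succ_apply', ih, twist_mul, twist_sub, twist_X, twist_C,
      ← Function.iterate_succ_apply' twist, ← pow_mul, ← pow_succ]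

/-- Iterating the functional equation, Ω is its i-fold twist times ∏_{k=1}^{i} (t - θ^(q^k)), and
that product equals L_i at t = θ. The form without division lets Ω(θ) ≠ 0 yield L_i ≠ 0. -/
lemma evalTheta_iterate_twist_omega_mul {ϖ : CInfty F}
    (hϖ : ϖ ^ (Fintype.card F - 1) = -theta F) (i : ℕ) :
    evalTheta (twist^[i] (omega ϖ)) * carlitzL F i = evalTheta (omega ϖ) := by
  induction i with
  | zero => simp [carlitzL]
  | succ i ih =>
    have hC := C_mem_thetaTate (theta F ^ Fintype.card F ^ (i + 1))
    rw [carlitzL, Finset.prod_range_succ, ← carlitzL, ← ih, iterate_twist_omega hϖ i,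
      evalTheta_mul ((thetaTate F).sub_mem X_mem_thetaTate hC)
        (coeffBound_iterate_twist_omega ϖ _).mem_thetaTate,
      evalTheta_sub X_mem_thetaTate hC, evalTheta_X, evalTheta_C]
    ring

lemma carlitzL_ne_zero {ϖ : CInfty F} (hϖ : ϖ ^ (Fintype.card F - 1) = -theta F) (i : ℕ) :
    carlitzL F i ≠ 0 := by
  refine right_ne_zero_of_mul (a := evalTheta (twist^[i] (omega ϖ))) ?_
  rw [evalTheta_iterate_twist_omega_mul hϖ]
  exact evalTheta_omega_ne_zero hϖ

lemma evalTheta_iterate_twist_omega {ϖ : CInfty F}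
    (hϖ : ϖ ^ (Fintype.card F - 1) = -theta F) (i : ℕ) :
    evalTheta (twist^[i] (omega ϖ)) = evalTheta (omega ϖ) / carlitzL F i := by
  rw [eq_div_iff (carlitzL_ne_zero hϖ i), evalTheta_iterate_twist_omega_mul hϖ]

/-- As |ϖ|^(q-1) = |θ|, the real power in `DStar` is the inverse of the size of the constant term of
Ω^m. The convergence condition thus becomes a coefficient bound. -/
lemma norm_theta_rpow {ϖ : CInfty F} (hϖ : ϖ ^ (Fintype.card F - 1) = -theta F) (m : ℕ) :
    ‖theta F‖ ^ ((Fintype.card F * m : ℝ) / (Fintype.card F - 1)) =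
      (‖ϖ‖ ^ Fintype.card F) ^ m := by
  have hq : (Fintype.card F : ℝ) - 1 ≠ 0 := by
    have := one_lt_card (F := F); linarith
  rw [← norm_neg (theta F), ← hϖ, norm_pow, ← Real.rpow_natCast, ← Real.rpow_mul (norm_nonneg _),
    ← pow_mul, ← Real.rpow_natCast, Nat.cast_sub Fintype.card_pos]
  congr 1
  push_cast
  field_simp

/-! ### Solutions of the difference systems -/

section solutions
variable {d : ℕ} {Z : Fin d → (CInfty F)⟦X⟧} {Y Y' : (CInfty F)⟦X⟧}
  {G G' : Fin (d + 1) → (CInfty F)⟦X⟧}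

lemma IsStarSolution.add (h : IsStarSolution Z Y G) (h' : IsStarSolution Z Y' G') :
    IsStarSolution Z (Y + Y') (G + G') :=
  ⟨fun j => (tate F).add_mem (h.1 j) (h'.1 j),
    fun j => by rw [Pi.add_apply, Pi.add_apply, wp_add, h.2.1, h'.2.1, mul_add],
    by rw [Pi.add_apply, wp_add, h.2.2, h'.2.2]⟩

lemma IsStarSolution.sub (h : IsStarSolution Z Y G) (h' : IsStarSolution Z Y' G') :
    IsStarSolution Z (Y - Y') (G - G') :=
  ⟨fun j => (tate F).sub_mem (h.1 j) (h'.1 j),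
    fun j => by rw [Pi.sub_apply, Pi.sub_apply, wp_sub, h.2.1, h'.2.1, mul_sub],
    by rw [Pi.sub_apply, wp_sub, h.2.2, h'.2.2]⟩

lemma IsStarSolution.smul (h : IsStarSolution Z Y G) (p : Polynomial F) :
    IsStarSolution Z (polyToSeries p * Y) (p • G) :=
  ⟨fun j => by
    rw [Pi.smul_apply, smul_eq_polyToSeries_mul]
    exact (tate F).mul_mem (polyToSeries_mem_tate p) (h.1 j),
    fun j => by
      simp only [Pi.smul_apply, smul_eq_polyToSeries_mul]
      rw [wp_mul_of_twist_eq (twist_polyToSeries p), h.2.1]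
      ring,
    by rw [Pi.smul_apply, smul_eq_polyToSeries_mul,
      wp_mul_of_twist_eq (twist_polyToSeries p), h.2.2]⟩

lemma isStarSolution_zero : IsStarSolution Z 0 0 :=
  ⟨fun _ => (tate F).zero_mem, fun j => by simp [wp_zero], by simp [wp_zero]⟩

lemma IsStarSolution.mem_thetaTate (h : IsStarSolution Z Y G) (hZ : ∀ j, Z j ∈ thetaTate F)
    (hY : Y ∈ thetaTate F) (j : Fin (d + 1)) : G j ∈ thetaTate F := by
  induction j using Fin.reverseInduction with
  | last => exact mem_thetaTate_of_wp (h.1 _) (by rwa [h.2.2])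
  | cast j ih =>
    exact mem_thetaTate_of_wp (h.1 _) (by rw [h.2.1]; exact (thetaTate F).mul_mem (hZ j) ih)

/-- The entry 1 at position k is killed by ℘ and followed by 0, so the equations at and after k hold
trivially. -/
lemma IsStarGenerator.isStarSolution {k : Fin (d + 1)} (h : IsStarGenerator Z k G) :
    IsStarSolution Z 0 G := by
  obtain ⟨h1, h2, h3, h4⟩ := h
  refine ⟨h1, fun j => ?_, ?_⟩
  · rcases lt_trichotomy j.castSucc k with hj | hj | hj
    · exact h2 j hj
    · rw [hj, h3, wp_one, h4 _ (hj ▸ Fin.castSucc_lt_succ), mul_zero]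
    · rw [h4 _ hj, h4 _ (hj.trans Fin.castSucc_lt_succ), wp_zero, mul_zero]
  · rcases (Fin.le_last k).eq_or_lt with hk | hk
    · rw [← hk, h3, wp_one]
    · rw [h4 _ hk, wp_zero]

lemma exists_isStarGenerator {d : ℕ} (Z : Fin d → (CInfty F)⟦X⟧) (hZ : ∀ j, Z j ∈ tate F)
    (k : Fin (d + 1)) : ∃ G, IsStarGenerator Z k G := by
  induction d with
  | zero =>
    refine ⟨fun _ => 1, fun _ => (tate F).one_mem, fun j => j.elim0, rfl, fun j hj => ?_⟩
    have hj' : (k : ℕ) < j := hj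
    omega
  | succ d ih =>
    cases k using Fin.cases with
    | zero =>
      refine ⟨Fin.cons 1 0, fun j => ?_, fun j hj => absurd hj (Fin.not_lt_zero _), rfl,
        fun j hj => ?_⟩
      · cases j using Fin.cases with
        | zero => exact (tate F).one_mem
        | succ j => exact (tate F).zero_mem
      · cases j using Fin.cases with
        | zero => exact absurd hj (lt_irrefl _)
        | succ j => rfl
    | succ k =>
      obtain ⟨G, hG, hG1, hG2, hG3⟩ := ih (fun j => Z j.succ) (fun j => hZ _) k
      obtain ⟨g, hg, h⟩ := exists_wp_eq (Z 0 * G 0) ((tate F).mul_mem (hZ 0) (hG 0))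
      refine ⟨Fin.cons g G, fun j => ?_, fun j hj => ?_, hG2, fun j hj => ?_⟩
      · cases j using Fin.cases with
        | zero => exact hg
        | succ j => exact hG j
      · cases j using Fin.cases with
        | zero => exact h
        | succ j =>
          rw [← Fin.succ_castSucc] at hj ⊢
          rw [Fin.cons_succ, Fin.cons_succ]
          exact hG1 j (Fin.succ_lt_succ_iff.1 hj)
      · cases j using Fin.cases with
        | zero => exact absurd hj (Fin.not_lt_zero _)
        | succ j => exact hG3 j (Fin.succ_lt_succ_iff.1 hj)

lemma IsStarSolution.wp_eq_zero (h : IsStarSolution Z 0 G) {k : Fin (d + 1)}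
    (h0 : ∀ j, k < j → G j = 0) : wp (G k) = 0 := by
  cases k using Fin.lastCases with
  | last => exact h.2.2
  | cast k => rw [h.2.1, h0 _ Fin.castSucc_lt_succ, mul_zero]

lemma isStarSolution_of_mem_starModuleZero (h : G ∈ starModuleZero Z) :
    IsStarSolution Z 0 G := by
  induction h using Submodule.span_induction with
  | mem G hG =>
    obtain ⟨k, hk⟩ := hG
    exact hk.isStarSolution
  | zero => exact isStarSolution_zero
  | add G G' _ _ hG hG' => simpa using hG.add hG'
  | smul p G _ hG => simpa using hG.smul p

/-- If all coordinates after k vanish, the k-th is killed by ℘, hence is a polynomial p. Subtracting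
p times a generator with entry 1 at k clears it. -/
lemma mem_starModuleZero_of_isStarSolution (hZ : ∀ j, Z j ∈ tate F) (h : IsStarSolution Z 0 G) :
    G ∈ starModuleZero Z := by
  -- Induction on the number k of leading coordinates allowed to be nonzero.
  suffices H : ∀ k ≤ d + 1, ∀ G : Fin (d + 1) → (CInfty F)⟦X⟧, IsStarSolution Z 0 G →
      (∀ j : Fin (d + 1), k ≤ j → G j = 0) → G ∈ starModuleZero Z from
    H (d + 1) le_rfl G h fun j hj => absurd hj (not_le.2 j.2)
  intro k
  induction k with
  | zero =>
    intro _ G _ h0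
    rw [show G = 0 from funext fun j => h0 j (Nat.zero_le _)]
    exact Submodule.zero_mem _
  | succ k ih =>
    intro hk G hG h0
    obtain ⟨p, hp⟩ := exists_polyToSeries_of_wp_eq_zero (hG.1 ⟨k, hk⟩)
      (hG.wp_eq_zero fun j hj => h0 j hj)
    obtain ⟨G₁, hG₁⟩ := exists_isStarGenerator Z hZ ⟨k, hk⟩
    have hmem : G₁ ∈ starModuleZero Z := Submodule.subset_span ⟨_, hG₁⟩
    rw [← sub_add_cancel G (p • G₁)]
    refine Submodule.add_mem _ (ih (Nat.le_of_succ_le hk) _ ?_ fun j hj => ?_)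
      (Submodule.smul_mem _ p hmem)
    · simpa using hG.sub (hG₁.isStarSolution.smul p)
    · rw [Pi.sub_apply, Pi.smul_apply, smul_eq_polyToSeries_mul, hp]
      rcases hj.eq_or_lt with hj | hj
      · obtain rfl : j = ⟨k, hk⟩ := Fin.ext hj.symm
        rw [hG₁.2.2.1, mul_one, sub_self]
      · rw [h0 j hj, hG₁.2.2.2 j hj, mul_zero, sub_zero]

/-- The last coordinate is a polynomial with |p(θ)| < 1, hence 0; then the preceding coordinate is
killed by ℘ and the argument repeats. -/
lemma IsStarSolution.eq_zero_of_norm_evalTheta_lt_one (h : IsStarSolution Z 0 G)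
    (hlt : ∀ j, ‖evalTheta (G j)‖ < 1) : G = 0 := by
  have key : ∀ j, wp (G j) = 0 → G j = 0 := fun j hj => by
    obtain ⟨p, hp⟩ := exists_polyToSeries_of_wp_eq_zero (h.1 j) hj
    rcases eq_or_ne p 0 with rfl | hp0
    · rw [← hp, polyToSeries, map_zero]
    · have h1 := hlt j
      rw [← hp] at h1
      exact absurd h1 (not_lt.2 (one_le_norm_evalTheta_polyToSeries hp0))
  ext1 j
  induction j using Fin.reverseInduction with
  | last => exact key _ h.2.2
  | cast j ih => exact key _ (by rw [h.2.1, ih, Pi.zero_apply, mul_zero])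

end solutions

/-! ### Evaluation of branches and the monodromy module -/

section branches
variable {d : ℕ} {ϖ : CInfty F} {n : Fin (d + 1) → ℕ} {z : Fin d → CInfty F}

lemma omega_pow_mul_C_mem_thetaTate (ϖ : CInfty F) (m : ℕ) (c : CInfty F) :
    omega ϖ ^ m * C c ∈ thetaTate F :=
  (thetaTate F).mul_mem ((thetaTate F).pow_mem (omega_mem_thetaTate ϖ) m) (C_mem_thetaTate c)

lemma omega_inv_pow_mul_mem_thetaTate (ϖ : CInfty F) (m : ℕ) {f : (CInfty F)⟦X⟧}
    (hf : f ∈ thetaTate F) : (omega ϖ)⁻¹ ^ m * f ∈ thetaTate F :=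
  (thetaTate F).mul_mem ((thetaTate F).pow_mem (omega_inv_mem_thetaTate ϖ) m) hf

lemma evalTheta_omega_inv_pow_mul (hϖ : ϖ ^ (Fintype.card F - 1) = -theta F) (m : ℕ)
    {f : (CInfty F)⟦X⟧} (hf : f ∈ thetaTate F) :
    evalTheta ((omega ϖ)⁻¹ ^ m * f) = piTilde ϖ ^ m * evalTheta f := by
  rw [evalTheta_mul ((thetaTate F).pow_mem (omega_inv_mem_thetaTate ϖ) m) hf,
    evalTheta_pow (omega_inv_mem_thetaTate ϖ), evalTheta_omega_inv hϖ]

/-- Solutions of the difference system attached to the arguments `z_1, …, z_d`. -/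
abbrev IsStarSol (ϖ : CInfty F) (n : Fin (d + 1) → ℕ) (z : Fin d → CInfty F)
    (Y : (CInfty F)⟦X⟧) (H : Fin (d + 1) → (CInfty F)⟦X⟧) : Prop :=
  IsStarSolution (fun j => omega ϖ ^ n j.castSucc * C (z j)) Y H

lemma IsStarSol.mem_thetaTate {Y : (CInfty F)⟦X⟧} {H : Fin (d + 1) → (CInfty F)⟦X⟧}
    (h : IsStarSol ϖ n z Y H) (hY : Y ∈ thetaTate F) (j : Fin (d + 1)) : H j ∈ thetaTate F :=
  IsStarSolution.mem_thetaTate h (fun _ => omega_pow_mul_C_mem_thetaTate _ _ _) hY j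

lemma evalTheta_mem_monodromy (hϖ : ϖ ^ (Fintype.card F - 1) = -theta F)
    {H : Fin (d + 1) → (CInfty F)⟦X⟧} (h : IsStarSol ϖ n z 0 H) :
    (fun j => piTilde ϖ ^ (∑ l, n l) * evalTheta (H j)) ∈ monodromy ϖ n z := by
  refine Submodule.subset_span ⟨(omega ϖ)⁻¹ ^ (∑ j, n j) • H, ?_, fun j => ?_⟩
  · exact Submodule.smul_mem_pointwise_smul _ _ _ (mem_starModuleZero_of_isStarSolution
      (fun _ => thetaTate_le_tate (omega_pow_mul_C_mem_thetaTate _ _ _)) h)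
  · rw [Pi.smul_apply, smul_eq_mul,
      evalTheta_omega_inv_pow_mul hϖ _ (h.mem_thetaTate (thetaTate F).zero_mem j)]

/-- Any solution H may replace the chosen one: their difference solves the homogeneous system and
evaluates into the monodromy module. -/
lemma liStarCont_eq_mk (hϖ : ϖ ^ (Fintype.card F - 1) = -theta F) {w : CInfty F}
    {H : Fin (d + 1) → (CInfty F)⟦X⟧}
    (h : IsStarSol ϖ n z (omega ϖ ^ n (Fin.last d) * C w) H) :
    liStarCont ϖ n z w =
      Submodule.Quotient.mk fun j => piTilde ϖ ^ (∑ l, n l) * evalTheta (H j) := by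
  obtain ⟨H', hH', hG'⟩ := (exists_isStarBranch ϖ n z w).choose_spec
  have hY := omega_pow_mul_C_mem_thetaTate ϖ (n (Fin.last d)) w
  rw [liStarCont, Submodule.Quotient.eq]
  have h0 : IsStarSol ϖ n z 0 (H' - H) := by
    have := IsStarSolution.sub hH' h
    rwa [sub_self] at this
  convert! evalTheta_mem_monodromy hϖ h0 using 1
  ext1 j
  have h1 := IsStarSol.mem_thetaTate hH' hY j
  have h2 := h.mem_thetaTate hY j
  rw [Pi.sub_apply, hG', Pi.smul_apply, smul_eq_mul, evalTheta_omega_inv_pow_mul hϖ _ h1,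
    Pi.sub_apply, evalTheta_sub h1 h2, mul_sub]

lemma exists_isStarSol (ϖ : CInfty F) (n : Fin (d + 1) → ℕ) (z : Fin d → CInfty F)
    (w : CInfty F) : ∃ H, IsStarSol ϖ n z (omega ϖ ^ n (Fin.last d) * C w) H := by
  obtain ⟨-, H, hH, -⟩ := exists_isStarBranch ϖ n z w
  exact ⟨H, hH⟩

lemma summable_and_liStarCont_eq_mk (hϖ : ϖ ^ (Fintype.card F - 1) = -theta F) {w : CInfty F}
    {G : Fin (d + 1) → (CInfty F)⟦X⟧} (hG : IsStarBranch ϖ n (fun j => C (z j)) (C w) G) :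
    (∀ j, Summable fun i => coeff i (G j) * theta F ^ i) ∧
      liStarCont ϖ n z w = Submodule.Quotient.mk fun j => evalTheta (G j) := by
  obtain ⟨H, hH, rfl⟩ := hG
  have hm := IsStarSol.mem_thetaTate hH (omega_pow_mul_C_mem_thetaTate ϖ (n (Fin.last d)) w)
  refine ⟨fun j => mem_thetaTate.1 (omega_inv_pow_mul_mem_thetaTate ϖ _ (hm j)), ?_⟩
  rw [liStarCont_eq_mk hϖ hH]
  congr 1
  ext1 j
  rw [Pi.smul_apply, smul_eq_mul, evalTheta_omega_inv_pow_mul hϖ _ (hm j)]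

lemma polyToSeries_C (c : F) : polyToSeries (Polynomial.C c) = C (algebraMap F (CInfty F) c) := by
  ext i
  rw [coeff_polyToSeries, Polynomial.coeff_C, coeff_C]
  split_ifs <;> simp

lemma isLinearMap_liStarCont (hϖ : ϖ ^ (Fintype.card F - 1) = -theta F) :
    IsLinearMap F (liStarCont ϖ n z) where
  map_add w w' := by
    obtain ⟨H, hH⟩ := exists_isStarSol ϖ n z w
    obtain ⟨H', hH'⟩ := exists_isStarSol ϖ n z w'
    have h : IsStarSol ϖ n z (omega ϖ ^ n (Fin.last d) * C (w + w')) (H + H') := by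
      rw [map_add, mul_add]
      exact IsStarSolution.add hH hH'
    rw [liStarCont_eq_mk hϖ hH, liStarCont_eq_mk hϖ hH', liStarCont_eq_mk hϖ h,
      ← Submodule.Quotient.mk_add]
    congr 1
    ext1 j
    rw [Pi.add_apply, Pi.add_apply, evalTheta_add
      (hH.mem_thetaTate (omega_pow_mul_C_mem_thetaTate _ _ _) j)
      (hH'.mem_thetaTate (omega_pow_mul_C_mem_thetaTate _ _ _) j), mul_add]
  map_smul c w := by
    obtain ⟨H, hH⟩ := exists_isStarSol ϖ n z w
    have h : IsStarSol ϖ n z (omega ϖ ^ n (Fin.last d) * C (c • w)) (Polynomial.C c • H) := by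
      have h1 := IsStarSolution.smul hH (Polynomial.C c)
      rw [polyToSeries_C, mul_left_comm, ← map_mul] at h1
      rwa [Algebra.smul_def]
    rw [liStarCont_eq_mk hϖ hH, liStarCont_eq_mk hϖ h, ← Submodule.Quotient.mk_smul]
    congr 1
    ext1 j
    rw [Pi.smul_apply, Pi.smul_apply, smul_eq_polyToSeries_mul, polyToSeries_C, evalTheta_mul
      (C_mem_thetaTate _) (hH.mem_thetaTate (omega_pow_mul_C_mem_thetaTate _ _ _) j),
      evalTheta_C, Algebra.smul_def]
    ring

lemma evalTheta_polyToSeries_eq_aeval (p : Polynomial F) :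
    evalTheta (polyToSeries p) = Polynomial.aeval (theta F) p := by
  rw [Polynomial.aeval_eq_sum_range, evalTheta, tsum_eq_sum (s := Finset.range (p.natDegree + 1))]
  · refine Finset.sum_congr rfl fun i _ => ?_
    rw [coeff_polyToSeries, Algebra.smul_def]
  · intro i hi
    rw [coeff_polyToSeries, Polynomial.coeff_eq_zero_of_natDegree_lt (by simpa using hi), map_zero,
      zero_mul]

/-- Evaluation is semilinear along t ↦ θ, so the evaluated solutions are already closed under A and
taking the span adds nothing. -/
lemma exists_isStarSol_of_mem_monodromy (hϖ : ϖ ^ (Fintype.card F - 1) = -theta F)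
    {v : Fin (d + 1) → CInfty F} (hv : v ∈ monodromy ϖ n z) :
    ∃ H, IsStarSol ϖ n z 0 H ∧ ∀ j, v j = piTilde ϖ ^ (∑ l, n l) * evalTheta (H j) := by
  induction hv using Submodule.span_induction with
  | mem v hv =>
    obtain ⟨G, hG, hv⟩ := hv
    obtain ⟨H, hH, rfl⟩ := Submodule.mem_smul_pointwise_iff_exists _ _ _ |>.1 hG
    have hH' : IsStarSol ϖ n z 0 H := isStarSolution_of_mem_starModuleZero hH
    refine ⟨H, hH', fun j => ?_⟩
    rw [hv, Pi.smul_apply, smul_eq_mul,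
      evalTheta_omega_inv_pow_mul hϖ _ (hH'.mem_thetaTate (thetaTate F).zero_mem j)]
  | zero => exact ⟨0, isStarSolution_zero, fun j => by simp [evalTheta]⟩
  | add v v' _ _ h h' =>
    obtain ⟨H, hH, hv⟩ := h
    obtain ⟨H', hH', hv'⟩ := h'
    refine ⟨H + H', by simpa using IsStarSolution.add hH hH', fun j => ?_⟩
    rw [Pi.add_apply, hv, hv', Pi.add_apply, evalTheta_add
      (hH.mem_thetaTate (thetaTate F).zero_mem j) (hH'.mem_thetaTate (thetaTate F).zero_mem j),
      mul_add]
  | smul a v _ h =>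
    obtain ⟨H, hH, hv⟩ := h
    obtain ⟨a, ha⟩ := a
    obtain ⟨p, rfl⟩ : ∃ p : Polynomial F, Polynomial.aeval (theta F) p = a := by
      rwa [ringA, Algebra.adjoin_singleton_eq_range_aeval] at ha
    refine ⟨p • H, by simpa using IsStarSolution.smul hH p, fun j => ?_⟩
    rw [Pi.smul_apply, Pi.smul_apply, smul_eq_polyToSeries_mul, evalTheta_mul
      (polyToSeries_mem_thetaTate p) (hH.mem_thetaTate (thetaTate F).zero_mem j), hv,
      evalTheta_polyToSeries_eq_aeval, Subalgebra.smul_def, smul_eq_mul]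
    ring

/-- Dividing by π̃^N leaves a homogeneous solution whose values at θ all have norm below 1. -/
lemma eq_zero_of_mem_monodromy (hϖ : ϖ ^ (Fintype.card F - 1) = -theta F)
    {v : Fin (d + 1) → CInfty F} (hv : v ∈ monodromy ϖ n z)
    (hlt : ‖v‖ < ‖piTilde ϖ ^ (∑ l, n l)‖) : v = 0 := by
  obtain ⟨H, hH, hvH⟩ := exists_isStarSol_of_mem_monodromy hϖ hv
  have hpos : 0 < ‖piTilde ϖ ^ (∑ l, n l)‖ := (norm_nonneg v).trans_lt hlt
  have h0 : H = 0 := IsStarSolution.eq_zero_of_norm_evalTheta_lt_one hH fun j => by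
    have h1 := (norm_le_pi_norm v j).trans_lt hlt
    rw [hvH, norm_mul] at h1
    exact (mul_lt_iff_lt_one_right hpos).1 h1
  ext1 j
  rw [hvH, h0]
  simp [evalTheta]

end branches

/-! ### Star series as power series in `t` -/

lemma hasSum_of_isCompl {E : Type*} [NormedField E] {α β γ : Type*} {f : α → E} {x x' : E}
    {a : β → α} {b : γ → α} (ha : Function.Injective a) (hb : Function.Injective b)
    (hab : IsCompl (Set.range a) (Set.range b)) (hx : HasSum (fun i => f (a i)) x)
    (hx' : HasSum (fun i => f (b i)) x') : HasSum f (x + x') :=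
  HasSum.add_isCompl (f := f) hab (ha.hasSum_range_iff.2 hx) (hb.hasSum_range_iff.2 hx')

/-- Coefficientwise summation of a family of power series. -/
def CoeffHasSum {E : Type*} [NormedField E] {α : Type*} (f : α → E⟦X⟧) (S : E⟦X⟧) : Prop :=
  ∀ m, HasSum (fun i => coeff m (f i)) (coeff m S)

namespace CoeffHasSum

section
variable {E : Type*} [NormedField E] {α β γ : Type*} {f : α → E⟦X⟧} {S S' : E⟦X⟧}

lemma unique (h : CoeffHasSum f S) (h' : CoeffHasSum f S') : S = S' := by
  ext m
  exact (h m).unique (h' m)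

lemma mul_left (h : CoeffHasSum f S) (g : E⟦X⟧) : CoeffHasSum (fun i => g * f i) (g * S) :=
  fun m => by
    simp only [coeff_mul]
    exact hasSum_sum fun p _ => (h p.2).mul_left _

lemma of_isCompl {a : β → α} {b : γ → α} (ha : Function.Injective a) (hb : Function.Injective b)
    (hab : IsCompl (Set.range a) (Set.range b)) (hS : CoeffHasSum (f ∘ a) S)
    (hS' : CoeffHasSum (f ∘ b) S') : CoeffHasSum f (S + S') := fun m => by
  rw [map_add]
  exact hasSum_of_isCompl ha hb hab (hS m) (hS' m)

end

lemma twist {α : Type*} {f : α → (CInfty F)⟦X⟧} {S : (CInfty F)⟦X⟧} (h : CoeffHasSum f S) :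
    CoeffHasSum (fun i => CarlitzStar.twist (f i)) (CarlitzStar.twist S) := fun m => by
  let φ := FiniteField.frobeniusAlgHom F (CInfty F)
  have hφ : ∀ x, φ x = x ^ Fintype.card F := fun x => rfl
  have hc : Continuous φ := by
    change Continuous fun x => φ x
    simp only [hφ]
    fun_prop
  have := (h m).map φ hc
  simpa only [coeff_twist, Function.comp_def, hφ] using! this

end CoeffHasSum

section star
variable {ι : Type*} [Fintype ι]

/-- The term `∏_j (Ω^(n_j) y_j)^((i_j))` of the star series. -/
def starTerm (ϖ : CInfty F) (n : ι → ℕ) (y : ι → CInfty F) (i : ι → ℕ) : (CInfty F)⟦X⟧ :=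
  ∏ j, twist^[i j] (omega ϖ ^ n j * C (y j))

/-- The quantity `∏_j |y_j / θ^(q n_j / (q - 1))| ^ (q^(i_j))`. -/
def starWeight (n : ι → ℕ) (y : ι → CInfty F) (i : ι → ℕ) : ℝ :=
  ∏ j, (‖y j‖ / ‖theta F‖ ^ ((Fintype.card F * n j : ℝ) / (Fintype.card F - 1))) ^
    Fintype.card F ^ i j

lemma iterate_twist_omega_pow_mul_C (ϖ : CInfty F) (m : ℕ) (c : CInfty F) (i : ℕ) :
    twist^[i] (omega ϖ ^ m * C c) =
      (twist^[i] (omega ϖ)) ^ m * C (c ^ Fintype.card F ^ i) := by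
  induction i with
  | zero => simp
  | succ i ih =>
    rw [Function.iterate_succ_apply', ih, twist_mul, twist_C, ← pow_mul, ← pow_succ,
      ← twistHom_apply, map_pow, twistHom_apply, Function.iterate_succ_apply']

lemma twist_starTerm (ϖ : CInfty F) (n : ι → ℕ) (y : ι → CInfty F) (i : ι → ℕ) :
    twist (starTerm ϖ n y i) = starTerm ϖ n y (fun j => i j + 1) := by
  rw [starTerm, starTerm, ← twistHom_apply, map_prod]
  refine Finset.prod_congr rfl fun j _ => ?_
  rw [twistHom_apply, Function.iterate_succ_apply']

lemma starWeight_nonneg (n : ι → ℕ) (y : ι → CInfty F) (i : ι → ℕ) : 0 ≤ starWeight n y i :=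
  Finset.prod_nonneg fun _ _ => by positivity

/-- Each factor contributes (|y_j| / |ϖ|^(q n_j))^(q^(i_j)), exactly its factor in the weight
defining `DStar`. Hence membership in `DStar` gives convergence uniformly on |t| ≤ |θ|. -/
lemma coeffBound_starTerm {ϖ : CInfty F} (hϖ : ϖ ^ (Fintype.card F - 1) = -theta F)
    (n : ι → ℕ) (y : ι → CInfty F) (i : ι → ℕ) :
    CoeffBound (starWeight n y i) (decay F) (starTerm ϖ n y i) := by
  refine CoeffBound.prod decay_nonneg _ fun j => ?_
  rw [iterate_twist_omega_pow_mul_C, norm_theta_rpow hϖ]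
  convert! ((coeffBound_iterate_twist_omega ϖ (i j)).pow decay_nonneg (n j)).mul decay_nonneg
    (CoeffBound.C decay_nonneg (y j ^ Fintype.card F ^ i j)) using 1
  rw [norm_pow, div_pow, div_eq_mul_inv, mul_comm, inv_pow, inv_pow, ← pow_mul, ← pow_mul,
    ← pow_mul, ← pow_mul, mul_comm (n j)]

lemma evalTheta_starTerm {ϖ : CInfty F} (hϖ : ϖ ^ (Fintype.card F - 1) = -theta F)
    (n : ι → ℕ) (y : ι → CInfty F) (i : ι → ℕ) :
    evalTheta (starTerm ϖ n y i) = evalTheta (omega ϖ) ^ (∑ j, n j) *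
      ∏ j, y j ^ Fintype.card F ^ i j / carlitzL F (i j) ^ n j := by
  have hm : ∀ j, twist^[i j] (omega ϖ) ∈ thetaTate F := fun j =>
    (coeffBound_iterate_twist_omega ϖ (i j)).mem_thetaTate
  rw [starTerm, evalTheta_prod]
  · rw [← Finset.prod_pow_eq_pow_sum, ← Finset.prod_mul_distrib]
    refine Finset.prod_congr rfl fun j _ => ?_
    rw [iterate_twist_omega_pow_mul_C, evalTheta_mul ((thetaTate F).pow_mem (hm j) _)
      (C_mem_thetaTate _), evalTheta_pow (hm j), evalTheta_C, evalTheta_iterate_twist_omega hϖ,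
      div_pow]
    ring
  · intro j
    rw [iterate_twist_omega_pow_mul_C]
    exact (thetaTate F).mul_mem ((thetaTate F).pow_mem (hm j) _) (C_mem_thetaTate _)

variable [LinearOrder ι]

/-- The star series `∑_{i_1 ≤ ⋯ ≤ i_m} ∏_j (Ω^(n_j) y_j)^((i_j))`. -/
def starSeries (ϖ : CInfty F) (n : ι → ℕ) (y : ι → CInfty F) : (CInfty F)⟦X⟧ :=
  PowerSeries.mk fun m => ∑' i : {i : ι → ℕ // Monotone i}, coeff m (starTerm ϖ n y i)

variable {ϖ : CInfty F} {n : ι → ℕ} {y : ι → CInfty F}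

lemma coeffHasSum_starSeries (hϖ : ϖ ^ (Fintype.card F - 1) = -theta F) (hy : y ∈ DStar n) :
    CoeffHasSum (fun i : {i : ι → ℕ // Monotone i} => starTerm ϖ n y i) (starSeries ϖ n y) :=
  fun m => by
    rw [starSeries, coeff_mk]
    refine (summable_iff_tendsto_norm.2 ?_).hasSum
    refine squeeze_zero (fun _ => norm_nonneg _)
      (fun i => coeffBound_starTerm hϖ n y i.1 m) ?_
    have h : Tendsto (fun i : {i : ι → ℕ // Monotone i} => starWeight n y i) cofinite (𝓝 0) := hy
    simpa using h.mul_const (decay F ^ m)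

lemma exists_coeffBound_starSeries (hϖ : ϖ ^ (Fintype.card F - 1) = -theta F)
    (hy : y ∈ DStar n) : ∃ B, CoeffBound B (decay F) (starSeries ϖ n y) := by
  have h : Tendsto (fun i : {i : ι → ℕ // Monotone i} => starWeight n y i) cofinite (𝓝 0) := hy
  obtain ⟨B, hB⟩ := h.bddAbove_range_of_cofinite
  have hB' : ∀ i : {i : ι → ℕ // Monotone i}, starWeight n y i ≤ B := fun i => hB ⟨i, rfl⟩
  have hB0 : 0 ≤ B := (starWeight_nonneg n y _).trans (hB' ⟨fun _ => 0, monotone_const⟩)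
  refine ⟨B, fun m => ?_⟩
  have hd := decay_nonneg (F := F)
  rw [← (coeffHasSum_starSeries hϖ hy m).tsum_eq]
  refine IsUltrametricDist.norm_tsum_le_of_forall_le_of_nonneg (by positivity) fun i => ?_
  refine (coeffBound_starTerm hϖ n y i.1 m).trans ?_
  gcongr
  exact hB' i

lemma starSeries_mem_thetaTate (hϖ : ϖ ^ (Fintype.card F - 1) = -theta F)
    (hy : y ∈ DStar n) : starSeries ϖ n y ∈ thetaTate F := by
  obtain ⟨B, hB⟩ := exists_coeffBound_starSeries hϖ hy
  exact hB.mem_thetaTate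

/-- Interchange of the sums over tuples and over powers of t. The double family is bounded by the
weight of the tuple times q^(-m), a product of two null families, hence is summable in the
ultrametric setting. -/
lemma hasSum_evalTheta_starTerm (hϖ : ϖ ^ (Fintype.card F - 1) = -theta F)
    (hy : y ∈ DStar n) :
    HasSum (fun i : {i : ι → ℕ // Monotone i} => evalTheta (starTerm ϖ n y i))
      (evalTheta (starSeries ϖ n y)) := by
  have h : Tendsto (fun i : {i : ι → ℕ // Monotone i} => starWeight n y i) cofinite (𝓝 0) := hy
  have hsum : Summable fun p : ℕ × {i : ι → ℕ // Monotone i} =>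
      coeff p.1 (starTerm ϖ n y p.2) * theta F ^ p.1 := by
    rw [summable_iff_tendsto_norm]
    have hl := tendsto_mul_cofinite_nhds_zero
      (Nat.cofinite_eq_atTop ▸ tendsto_inv_card_pow (F := F)) h
    refine squeeze_zero (fun _ => norm_nonneg _) (fun p => ?_) hl
    rw [mul_comm (_ ^ _)]
    exact (coeffBound_starTerm hϖ n y p.2.1).norm_mul_theta_pow_le p.1
  have h1 : HasSum (fun p : ℕ × {i : ι → ℕ // Monotone i} =>
      coeff p.1 (starTerm ϖ n y p.2) * theta F ^ p.1) (evalTheta (starSeries ϖ n y)) := by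
    -- Summing over tuples first produces the coefficients of the star series, so the total is its
    -- value at θ.
    have h2 := hsum.hasSum
    rwa [(h2.prod_fiberwise fun m =>
      (coeffHasSum_starSeries hϖ hy m).mul_right (theta F ^ m)).tsum_eq.symm] at h2
  refine ((Equiv.prodComm _ _).hasSum_iff.2 h1).prod_fiberwise fun i => ?_
  exact (mem_thetaTate.1 (coeffBound_starTerm hϖ n y i.1).mem_thetaTate).hasSum

lemma hasSum_liStar (hϖ : ϖ ^ (Fintype.card F - 1) = -theta F) (hy : y ∈ DStar n) :
    HasSum (fun i : {i : ι → ℕ // Monotone i} =>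
      ∏ j, y j ^ Fintype.card F ^ i.1 j / carlitzL F (i.1 j) ^ n j) (liStar n y) := by
  have h := hasSum_evalTheta_starTerm hϖ hy
  simp only [evalTheta_starTerm hϖ] at h
  have hc := pow_ne_zero (∑ j, n j) (evalTheta_omega_ne_zero hϖ)
  have h' := h.summable.mul_left (evalTheta (omega ϖ) ^ ∑ j, n j)⁻¹
  simp only [inv_mul_cancel_left₀ hc] at h'
  exact h'.hasSum

lemma evalTheta_starSeries (hϖ : ϖ ^ (Fintype.card F - 1) = -theta F) (hy : y ∈ DStar n) :
    evalTheta (starSeries ϖ n y) = evalTheta (omega ϖ) ^ (∑ j, n j) * liStar n y := by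
  have h := hasSum_evalTheta_starTerm hϖ hy
  simp only [evalTheta_starTerm hϖ] at h
  exact h.unique ((hasSum_liStar hϖ hy).mul_left _)

end star

/-! ### The difference equations of the star series -/

section restriction
variable {ι κ : Type*}

lemma prod_extend_zero [Fintype ι] [Fintype κ] [DecidableEq ι] {R : Type*} [CommMonoid R]
    (φ : κ ↪ ι) (g : ι → ℕ → R) (i : κ → ℕ) : ∏ x, g x (Function.extend φ i 0 x) =
      (∏ x ∈ (Finset.univ.map φ)ᶜ, g x 0) * ∏ k, g (φ k) (i k) := by
  rw [← Finset.prod_compl_mul_prod (Finset.univ.map φ), Finset.prod_map]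
  congr 1
  · refine Finset.prod_congr rfl fun x hx => ?_
    rw [Function.extend_apply', Pi.zero_apply]
    simpa using hx
  · refine Finset.prod_congr rfl fun k _ => ?_
    rw [φ.injective.extend_apply]

variable [LinearOrder ι] [LinearOrder κ] {φ : κ ↪o ι}

lemma monotone_extend_zero (hφ : IsUpperSet (Set.range φ)) {i : κ → ℕ} (hi : Monotone i) :
    Monotone (Function.extend φ i 0) := fun x y hxy => by
  by_cases hx : x ∈ Set.range φ
  · obtain ⟨l, hl⟩ := hφ hxy hx
    obtain ⟨k, rfl⟩ := hx
    subst hl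
    rw [φ.injective.extend_apply, φ.injective.extend_apply]
    exact hi (φ.le_iff_le.1 hxy)
  · rw [Function.extend_apply' _ _ _ hx]
    exact Nat.zero_le _

/-- Extension of a monotone tuple by zeros below. -/
def extendZero (hφ : IsUpperSet (Set.range φ)) (i : {i : κ → ℕ // Monotone i}) :
    {i : ι → ℕ // Monotone i} :=
  ⟨Function.extend φ i 0, monotone_extend_zero hφ i.2⟩

lemma extendZero_injective (hφ : IsUpperSet (Set.range φ)) :
    Function.Injective (extendZero hφ) := fun i i' h => by
  refine Subtype.ext (funext fun k => ?_)
  have h1 := congrFun (congrArg Subtype.val h) (φ k)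
  simpa only [extendZero, φ.injective.extend_apply] using h1

/-- Adding `1` to all entries of a monotone tuple. -/
def shiftOne (i : {i : ι → ℕ // Monotone i}) : {i : ι → ℕ // Monotone i} :=
  ⟨fun x => i.1 x + 1, fun _ _ h => Nat.succ_le_succ (i.2 h)⟩

lemma shiftOne_injective : Function.Injective (shiftOne (ι := ι)) := fun _ _ h =>
  Subtype.ext (funext fun x => Nat.succ_injective (congrFun (congrArg Subtype.val h) x))

lemma isUpperSet_range_of_bot {a : ι} (ha : ∀ x, a ≤ x) (hφ : ∀ x, x ∈ Set.range φ ↔ x ≠ a) :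
    IsUpperSet (Set.range φ) := fun x y hxy hx => by
  rw [hφ] at hx ⊢
  rintro rfl
  exact hx (le_antisymm hxy (ha x))

/-- If the entry at a, the smallest one, is positive, the tuple is a shift by one. Otherwise it is 0
and, the inequalities being weak, imposes nothing on the remaining monotone tuple. -/
lemma isCompl_range_shiftOne_extendZero {a : ι} (ha : ∀ x, a ≤ x)
    (hφ : ∀ x, x ∈ Set.range φ ↔ x ≠ a) :
    IsCompl (Set.range (shiftOne (ι := ι)))
      (Set.range (extendZero (isUpperSet_range_of_bot ha hφ))) := by
  have ha' : a ∉ Set.range φ := fun h => (hφ a).1 h rfl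
  rw [isCompl_iff, Set.disjoint_left, codisjoint_iff_le_sup]
  constructor
  · rintro _ ⟨i, rfl⟩ ⟨i', h⟩
    have h1 := congrFun (congrArg Subtype.val h) a
    simp only [extendZero, shiftOne, Function.extend_apply' _ _ _ ha', Pi.zero_apply] at h1
    exact absurd h1 (Nat.succ_ne_zero _).symm
  · intro i _
    rcases Nat.eq_zero_or_pos (i.1 a) with h | h
    · refine Or.inr ⟨⟨fun k => i.1 (φ k), fun _ _ hkl => i.2 (φ.monotone hkl)⟩,
        Subtype.ext (funext fun x => ?_)⟩
      by_cases hx : x ∈ Set.range φ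
      · obtain ⟨k, rfl⟩ := hx
        simp only [extendZero, φ.injective.extend_apply]
      · simp only [extendZero, Function.extend_apply' _ _ _ hx, Pi.zero_apply]
        rw [hφ, not_not] at hx
        rw [hx, h]
    · have h' : ∀ x, 1 ≤ i.1 x := fun x => le_trans (Nat.succ_le_of_lt h) (i.2 (ha x))
      exact Or.inl ⟨⟨fun x => i.1 x - 1, fun _ _ hxy => Nat.sub_le_sub_right (i.2 hxy) 1⟩,
        Subtype.ext (funext fun x => Nat.sub_add_cancel (h' x))⟩

variable [Fintype ι] [Fintype κ]

/-- Padding a tuple with zeros multiplies its weight by a constant depending only on the dropped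
variables. When these are nonzero the constant can be divided out; a zero variable would hide
divergence of the tail. -/
lemma comp_mem_DStar (hφ : IsUpperSet (Set.range φ)) {n : ι → ℕ} {y : ι → CInfty F}
    (hy : y ∈ DStar n) (h0 : ∀ x ∉ Set.range φ, y x ≠ 0) :
    (fun k => y (φ k)) ∈ DStar fun k => n (φ k) := by
  have h : Tendsto (fun i : {i : ι → ℕ // Monotone i} => starWeight n y i) cofinite (𝓝 0) := hy
  have h1 := h.comp (extendZero_injective hφ).tendsto_cofinite
  have hc : ∏ x ∈ (Finset.univ.map φ.toEmbedding)ᶜ,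
      (‖y x‖ / ‖theta F‖ ^ ((Fintype.card F * n x : ℝ) / (Fintype.card F - 1))) ^
        Fintype.card F ^ 0 ≠ 0 := by
    refine Finset.prod_ne_zero_iff.2 fun x hx => pow_ne_zero _ (div_ne_zero ?_ ?_)
    · exact norm_ne_zero_iff.2 (h0 x (by simpa using hx))
    · exact (Real.rpow_pos_of_pos (norm_pos_iff.2 theta_ne_zero) _).ne'
  have h2 := h1.const_mul (∏ x ∈ (Finset.univ.map φ.toEmbedding)ᶜ,
      (‖y x‖ / ‖theta F‖ ^ ((Fintype.card F * n x : ℝ) / (Fintype.card F - 1))) ^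
        Fintype.card F ^ 0)⁻¹
  rw [mul_zero] at h2
  refine h2.congr fun i => ?_
  have h3 := prod_extend_zero φ.toEmbedding (fun x m =>
    (‖y x‖ / ‖theta F‖ ^ ((Fintype.card F * n x : ℝ) / (Fintype.card F - 1))) ^
        Fintype.card F ^ m) i
  rw [inv_mul_eq_iff_eq_mul₀ hc]
  exact h3

/-- Shifted tuples sum to the twist; tuples starting with 0 leave the first factor untwisted, so it
comes out of the sum over the tail. -/
lemma wp_starSeries {ϖ : CInfty F} (hϖ : ϖ ^ (Fintype.card F - 1) = -theta F) {n : ι → ℕ}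
    {y : ι → CInfty F} (hy : y ∈ DStar n) {a : ι} (ha : ∀ x, a ≤ x)
    (hφ : ∀ x, x ∈ Set.range φ ↔ x ≠ a) (hy' : (fun k => y (φ k)) ∈ DStar fun k => n (φ k)) :
    wp (starSeries ϖ n y) =
      omega ϖ ^ n a * C (y a) * starSeries ϖ (fun k => n (φ k)) fun k => y (φ k) := by
  have hS := coeffHasSum_starSeries hϖ hy
  have h1 : CoeffHasSum ((fun i : {i : ι → ℕ // Monotone i} => starTerm ϖ n y i) ∘ shiftOne)
      (twist (starSeries ϖ n y)) := by
    have h := hS.twist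
    simp only [twist_starTerm] at h
    exact h
  have h2 : CoeffHasSum ((fun i : {i : ι → ℕ // Monotone i} => starTerm ϖ n y i) ∘
      extendZero (isUpperSet_range_of_bot ha hφ))
      (omega ϖ ^ n a * C (y a) * starSeries ϖ (fun k => n (φ k)) fun k => y (φ k)) := by
    convert! (coeffHasSum_starSeries hϖ hy').mul_left (omega ϖ ^ n a * C (y a)) using 1
    ext1 i
    refine (prod_extend_zero φ.toEmbedding
      (fun x m => twist^[m] (omega ϖ ^ n x * C (y x))) i).trans ?_
    have hcompl : (Finset.univ.map φ.toEmbedding)ᶜ = {a} := by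
      ext x
      have := hφ x
      simp only [Set.mem_range] at this
      simp [this]
    rw [hcompl, Finset.prod_singleton]
    rfl
  have h3 := hS.unique (CoeffHasSum.of_isCompl shiftOne_injective (extendZero_injective _)
    (isCompl_range_shiftOne_extendZero ha hφ) h1 h2)
  rw [wp]
  exact sub_eq_of_eq_add' h3

end restriction

lemma mem_DStar_of_isEmpty {ι : Type*} [Fintype ι] [LinearOrder ι] [IsEmpty ι] (n : ι → ℕ)
    (y : ι → CInfty F) : y ∈ DStar n := by
  change Tendsto _ cofinite _
  rw [Filter.cofinite_eq_bot]
  exact tendsto_bot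

lemma starSeries_of_isEmpty {ι : Type*} [Fintype ι] [LinearOrder ι] [IsEmpty ι] (ϖ : CInfty F)
    (n : ι → ℕ) (y : ι → CInfty F) : starSeries ϖ n y = 1 := by
  ext m
  have : Unique {i : ι → ℕ // Monotone i} :=
    { default := ⟨isEmptyElim, fun x => isEmptyElim x⟩
      uniq := fun i => Subtype.ext (funext fun x => isEmptyElim x) }
  rw [starSeries, coeff_mk, tsum_eq_single default fun i hi => absurd (Subsingleton.elim i _) hi,
    starTerm, Finset.univ_eq_empty, Finset.prod_empty]

/-! ### Tails of the argument tuple and part (1). -/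

section tails
variable {d : ℕ}

/-- The inclusion of final segments `{k + 1, …, d} ⊆ {k, …, d}`. -/
def iciSucc (k : Fin d) : Set.Ici k.succ ↪o Set.Ici k.castSucc where
  toFun l := ⟨l.1, Fin.castSucc_lt_succ.le.trans l.2⟩
  inj' _ _ h := Subtype.ext (congrArg (fun x : Set.Ici k.castSucc => x.1) h)
  map_rel_iff' := Iff.rfl

lemma mem_range_iciSucc {k : Fin d} (x : Set.Ici k.castSucc) :
    x ∈ Set.range (iciSucc k) ↔ x ≠ ⟨k.castSucc, Set.mem_Ici.2 le_rfl⟩ := by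
  constructor
  · rintro ⟨⟨l, hl⟩, rfl⟩ h
    have h' : l = k.castSucc := congrArg Subtype.val h
    subst h'
    exact absurd (Set.mem_Ici.1 hl) (not_le.2 Fin.castSucc_lt_succ)
  · intro h
    have hlt : k.castSucc < x.1 := lt_of_le_of_ne x.2 fun h' => h (Subtype.ext h'.symm)
    exact ⟨⟨x.1, Fin.castSucc_lt_iff_succ_le.1 hlt⟩, rfl⟩

lemma tail_mem_DStar {n : Fin (d + 1) → ℕ} {y : Fin (d + 1) → CInfty F} (hy : y ∈ DStar n)
    (h0 : ∀ j : Fin d, y j.castSucc ≠ 0) (j : Fin (d + 1)) :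
    (fun l : Set.Ici j => y l) ∈ DStar fun l : Set.Ici j => n l := by
  refine comp_mem_DStar (φ := OrderEmbedding.subtype (· ∈ Set.Ici j)) ?_ hy fun x hx => ?_
  · intro x x' hxx' hx
    obtain ⟨l, rfl⟩ := hx
    exact ⟨⟨x', le_trans (Set.mem_Ici.1 l.2) hxx'⟩, rfl⟩
  · cases x using Fin.lastCases with
    -- The last variable belongs to every tail, so it is never dropped and may vanish.
    | last => exact absurd ⟨⟨_, Fin.le_last j⟩, rfl⟩ hx
    | cast x => exact h0 x

variable {ϖ : CInfty F} {n : Fin (d + 1) → ℕ} {y : Fin (d + 1) → CInfty F}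

lemma isStarSol_starSeries (hϖ : ϖ ^ (Fintype.card F - 1) = -theta F)
    (hy : ∀ j : Fin (d + 1), (fun l : Set.Ici j => y l) ∈ DStar fun l : Set.Ici j => n l) :
    IsStarSol ϖ n (fun j => y j.castSucc) (omega ϖ ^ n (Fin.last d) * C (y (Fin.last d)))
      fun j => starSeries ϖ (fun l : Set.Ici j => n l) fun l : Set.Ici j => y l := by
  refine ⟨fun j => thetaTate_le_tate (starSeries_mem_thetaTate hϖ (hy j)), fun j => ?_, ?_⟩
  · exact wp_starSeries (φ := iciSucc j) hϖ (hy j.castSucc)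
      (a := ⟨j.castSucc, Set.mem_Ici.2 le_rfl⟩) (fun x => x.2) mem_range_iciSucc (hy j.succ)
  -- The last equation is the case of an empty tail, whose series is 1.
  · have h := wp_starSeries (κ := Fin 0) (ι := Set.Ici (Fin.last d))
      (φ := OrderEmbedding.ofIsEmpty) hϖ (hy (Fin.last d))
      (a := ⟨Fin.last d, Set.mem_Ici.2 le_rfl⟩) (fun x => x.2)
      (fun x => ⟨fun ⟨k, _⟩ => k.elim0,
        fun hx => absurd (Subtype.ext (le_antisymm (Fin.le_last _) x.2)) hx⟩)
      (mem_DStar_of_isEmpty _ _)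
    rwa [starSeries_of_isEmpty (ι := Fin 0), mul_one] at h

lemma sum_Iio_add_sum_Ici (n : Fin (d + 1) → ℕ) (j : Fin (d + 1)) :
    ∑ l ∈ Finset.Iio j, n l + ∑ l : Set.Ici j, n l = ∑ l, n l := by
  have h : ∑ l : Set.Ici j, n l = ∑ l ∈ Finset.Ici j, n l :=
    (Finset.sum_subtype (Finset.Ici j) (fun x => Finset.mem_Ici) n).symm
  have h2 : Finset.Iio j = (Finset.Ici j)ᶜ := by ext; simp
  rw [h, h2, Finset.sum_compl_add_sum]

lemma liStarCont_eq_liStar (hϖ : ϖ ^ (Fintype.card F - 1) = -theta F) {z : Fin d → CInfty F}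
    (hyz : ∀ j : Fin d, y j.castSucc = z j)
    (hy : ∀ j : Fin (d + 1), (fun l : Set.Ici j => y l) ∈ DStar fun l : Set.Ici j => n l) :
    liStarCont ϖ n z (y (Fin.last d)) =
      Submodule.Quotient.mk fun j : Fin (d + 1) => piTilde ϖ ^ (∑ l ∈ Finset.Iio j, n l) *
        liStar (fun l : Set.Ici j => n l) fun l : Set.Ici j => y l := by
  obtain rfl : (fun j : Fin d => y j.castSucc) = z := funext hyz
  rw [liStarCont_eq_mk hϖ (isStarSol_starSeries hϖ hy)]
  congr 1
  ext1 j
  have h : piTilde ϖ * evalTheta (omega ϖ) = 1 :=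
    div_mul_cancel₀ _ (evalTheta_omega_ne_zero hϖ)
  -- The exponents from j on cancel against Ω(θ) = 1/π̃, leaving the power of π̃ with the exponents
  -- before j.
  rw [evalTheta_starSeries hϖ (hy j), ← sum_Iio_add_sum_Ici n j, pow_add, mul_assoc,
    ← mul_assoc (piTilde ϖ ^ _) (evalTheta (omega ϖ) ^ _), ← mul_pow, h, one_pow, one_mul]

end tails

/-! ### Local analyticity -/

section analytic
variable {E : Type*} [NontriviallyNormedField E]

lemma IsRigidAnalyticOnDisk.const_add {f : E → E} {x₀ : E} {r : ℝ}
    (hf : IsRigidAnalyticOnDisk f x₀ r) (c : E) :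
    IsRigidAnalyticOnDisk (fun x => c + f x) x₀ r := by
  obtain ⟨a, ha, hsum⟩ := hf
  refine ⟨fun m => (if m = 0 then c else 0) + a m, ?_, fun x hx => ?_⟩
  · refine ha.congr' ?_
    filter_upwards [eventually_ne_atTop 0] with m hm
    rw [if_neg hm, zero_add]
  · have h0 : HasSum (fun m : ℕ => (if m = 0 then c else 0) * (x - x₀) ^ m) c := by
      have h := hasSum_ite_eq (0 : ℕ) c
      refine h.congr_fun fun m => ?_
      split_ifs with hm
      · rw [hm, pow_zero, mul_one]
      · rw [zero_mul]
    simpa only [add_mul] using h0.add (hsum x hx)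

variable [CompleteSpace E] [IsUltrametricDist E]

/-- Terms with the same exponent are grouped by unconditional summation. Convergence at the boundary
point w = ρ, with ρ^m divided out, gives both the coefficients and their decay. -/
lemma isRigidAnalyticOnDisk_of_hasSum {α : Type*} {c : α → E} {e : α → ℕ} {f : E → E} {x₀ ρ : E}
    (hρ : ρ ≠ 0)
    (hf : ∀ w, ‖w‖ ≤ ‖ρ‖ → HasSum (fun i => c i * w ^ e i) (f (x₀ + w))) :
    IsRigidAnalyticOnDisk f x₀ ‖ρ‖ := by
  have hfib : ∀ m, Summable fun i : {i // e i = m} => c i := fun m => by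
    have h := (hf ρ le_rfl).summable.subtype {i | e i = m}
    have h' : Summable fun i : {i // e i = m} => c i * ρ ^ m :=
      h.congr fun i => by
        have hi : e i.1 = m := i.2
        simp only [Function.comp_apply, hi]
    have h2 := h'.mul_right (ρ ^ m)⁻¹
    simpa only [mul_inv_cancel_right₀ (pow_ne_zero m hρ)] using h2
  have key : ∀ w, ‖w‖ ≤ ‖ρ‖ →
      HasSum (fun m => (∑' i : {i // e i = m}, c i) * w ^ m) (f (x₀ + w)) := fun w hw => by
    refine ((Equiv.sigmaFiberEquiv e).hasSum_iff.2 (hf w hw)).sigma fun m => ?_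
    refine ((hfib m).hasSum.mul_right (w ^ m)).congr_fun fun i => ?_
    have hi : e i.1 = m := i.2
    simp only [Function.comp_apply, Equiv.sigmaFiberEquiv_apply, hi]
  refine ⟨fun m => ∑' i : {i // e i = m}, c i, ?_, fun x hx => ?_⟩
  · have h := (key ρ le_rfl).summable.tendsto_atTop_zero.norm
    simpa only [norm_mul, norm_pow, norm_zero] using h
  · have h := key (x - x₀) (by rwa [← dist_eq_norm, ← Metric.mem_closedBall])
    rwa [add_sub_cancel] at h

end analytic

/-! ### Convergence for a small last variable. -/

section small
variable {ι : Type*} [Fintype ι] [LinearOrder ι] {b : ι}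

lemma tendsto_apply_top (hb : ∀ x, x ≤ b) :
    Tendsto (fun i : {i : ι → ℕ // Monotone i} => i.1 b) cofinite atTop := by
  refine tendsto_atTop.2 fun K => ?_
  have hfin : (Set.Icc (0 : ι → ℕ) fun _ => K).Finite := Set.finite_Icc _ _
  refine (hfin.preimage (Subtype.val_injective (p := Monotone)).injOn).subset fun i hi => ?_
  exact ⟨fun _ => Nat.zero_le _, fun x =>
    (i.2 (hb x)).trans (not_le.1 (show ¬K ≤ i.1 b from hi)).le⟩

/-- As A ≥ 1 and i_b is the largest entry, every exponent on A may be raised to q^(i_b). The weight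
is then at most (A^m ε)^(q^(i_b)) for m variables, and only finitely many tuples have bounded i_b.
-/
lemma mem_DStar_of_small (hb : ∀ x, x ≤ b) {n : ι → ℕ} {y : ι → CInfty F} {A ε : ℝ} (hA : 1 ≤ A)
    (hε : 0 ≤ ε) (hlt : A ^ Fintype.card ι * ε < 1)
    (hyA : ∀ x ≠ b, ‖y x‖ / ‖theta F‖ ^ ((Fintype.card F * n x : ℝ) / (Fintype.card F - 1)) ≤ A)
    (hyb : ‖y b‖ / ‖theta F‖ ^ ((Fintype.card F * n b : ℝ) / (Fintype.card F - 1)) ≤ A * ε) :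
    y ∈ DStar n := by
  have hlim : Tendsto (fun i : {i : ι → ℕ // Monotone i} =>
      (A ^ Fintype.card ι * ε) ^ Fintype.card F ^ i.1 b) cofinite (𝓝 0) :=
    (tendsto_pow_atTop_nhds_zero_of_lt_one (by positivity) hlt).comp
      ((tendsto_pow_atTop_atTop_of_one_lt Fintype.one_lt_card).comp (tendsto_apply_top hb))
  refine squeeze_zero (fun i => starWeight_nonneg n y i) (fun i => ?_) hlim
  have hprod : ∏ x : ι, A * (if x = b then ε else 1) = A ^ Fintype.card ι * ε := by
    rw [Finset.prod_mul_distrib, Finset.prod_const, Finset.card_univ, Finset.prod_ite_eq' _ b,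
      if_pos (Finset.mem_univ b)]
  rw [← hprod, ← Finset.prod_pow]
  refine Finset.prod_le_prod (fun x _ => by positivity) fun x _ => ?_
  split_ifs with hx
  · subst hx
    gcongr
  · rw [mul_one]
    calc _ ≤ A ^ Fintype.card F ^ i.1 x := by gcongr; exact hyA x hx
      _ ≤ _ := by
        gcongr
        · exact Fintype.card_pos
        · exact i.2 (hb x)

lemma liStar_term_eq {n : ι → ℕ} {y y' : ι → CInfty F} {w : CInfty F}
    (hy : ∀ x, y x = y' x * if x = b then w else 1) (i : ι → ℕ) :
    ∏ j, y j ^ Fintype.card F ^ i j / carlitzL F (i j) ^ n j =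
      (∏ j, y' j ^ Fintype.card F ^ i j / carlitzL F (i j) ^ n j) * w ^ Fintype.card F ^ i b := by
  have h : w ^ Fintype.card F ^ i b = ∏ x, if x = b then w ^ Fintype.card F ^ i x else 1 := by
    rw [Finset.prod_ite_eq' _ b, if_pos (Finset.mem_univ b)]
  rw [h, ← Finset.prod_mul_distrib]
  refine Finset.prod_congr rfl fun x _ => ?_
  rw [hy, mul_pow, ite_pow, one_pow]
  ring

end small

/-! ### Expansion near 0 and transport to an arbitrary centre: part (2). -/

section continuation
variable {d : ℕ}

/-- The tuple `(z_1, …, z_d, w)`. -/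
def snocArg (z : Fin d → CInfty F) (w : CInfty F) : Fin (d + 1) → CInfty F :=
  Fin.snoc (α := fun _ => CInfty F) z w

lemma snocArg_castSucc (z : Fin d → CInfty F) (w : CInfty F) (j : Fin d) :
    snocArg z w j.castSucc = z j := Fin.snoc_castSucc (α := fun _ => CInfty F) w z j

lemma snocArg_last (z : Fin d → CInfty F) (w : CInfty F) : snocArg z w (Fin.last d) = w :=
  Fin.snoc_last (α := fun _ => CInfty F) w z

lemma snocArg_eq (z : Fin d → CInfty F) (w : CInfty F) (j : Fin (d + 1)) :
    snocArg z w j = snocArg z 1 j * if j = Fin.last d then w else 1 := by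
  cases j using Fin.lastCases with
  | last => rw [snocArg_last, snocArg_last, if_pos rfl, one_mul]
  | cast j => rw [snocArg_castSucc, snocArg_castSucc, if_neg (Fin.castSucc_lt_last j).ne, mul_one]

lemma exists_forall_tail_mem_DStar (n : Fin (d + 1) → ℕ) (z : Fin d → CInfty F) :
    ∃ ρ : CInfty F, ρ ≠ 0 ∧ ∀ w, ‖w‖ ≤ ‖ρ‖ → ∀ j : Fin (d + 1),
      (fun l : Set.Ici j => snocArg z w l) ∈ DStar fun l : Set.Ici j => n l := by
  let T : Fin (d + 1) → ℝ := fun j =>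
    ‖theta F‖ ^ ((Fintype.card F * n j : ℝ) / (Fintype.card F - 1))
  have hT : ∀ j, 0 < T j := fun j => Real.rpow_pos_of_pos (norm_pos_iff.2 theta_ne_zero) _
  let A : ℝ := 1 + ∑ j : Fin d, ‖z j‖ / T j.castSucc
  have hzA : ∀ j : Fin d, ‖z j‖ / T j.castSucc ≤ A := fun j =>
    (Finset.single_le_sum (f := fun j : Fin d => ‖z j‖ / T j.castSucc)
      (fun j _ => div_nonneg (norm_nonneg _) (hT _).le) (Finset.mem_univ j)).trans
        (le_add_of_nonneg_left zero_le_one)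
  have hA : 1 ≤ A := le_add_of_nonneg_right
    (Finset.sum_nonneg fun j _ => div_nonneg (norm_nonneg _) (hT _).le)
  have hA0 : 0 < A := one_pos.trans_le hA
  -- A tail has at most d + 1 variables, so A to their number times ε is at most 1/2, for all tails
  -- at once.
  let ε : ℝ := (A ^ (d + 1) * 2)⁻¹
  have hε : 0 < ε := by positivity
  obtain ⟨ρ, hρ, hρlt⟩ := NormedField.exists_norm_lt (CInfty F)
    (mul_pos (mul_pos hA0 hε) (hT (Fin.last d)))
  refine ⟨ρ, norm_pos_iff.1 hρ, fun w hw j => ?_⟩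
  refine mem_DStar_of_small (b := ⟨Fin.last d, Set.mem_Ici.2 (Fin.le_last j)⟩)
    (fun x => Fin.le_last x.1) hA hε.le ?_ (fun x hx => ?_) ?_
  · have hcard : Fintype.card (Set.Ici j) ≤ d + 1 := by
      exact (Fintype.card_subtype_le (· ∈ Set.Ici j)).trans_eq (Fintype.card_fin _)
    calc A ^ Fintype.card (Set.Ici j) * ε ≤ A ^ (d + 1) * ε := by
          gcongr
      _ = 1 / 2 := by simp only [ε]; field_simp
      _ < 1 := by norm_num
  · obtain ⟨x, hxj⟩ := x
    cases x using Fin.lastCases with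
    | last => exact absurd rfl hx
    | cast x =>
      rw [snocArg_castSucc]
      exact hzA x
  · rw [snocArg_last]
    exact (div_le_iff₀ (hT (Fin.last d))).2 (hw.trans hρlt.le)

variable {ϖ : CInfty F}

lemma isLocallyRigidAnalytic_liStarCont (hϖ : ϖ ^ (Fintype.card F - 1) = -theta F)
    (n : Fin (d + 1) → ℕ) (z : Fin d → CInfty F) : IsLocallyRigidAnalytic (liStarCont ϖ n z) := by
  intro x₀
  obtain ⟨ρ₀, hρ₀, hD⟩ := exists_forall_tail_mem_DStar n z
  obtain ⟨c, hc⟩ := Submodule.Quotient.mk_surjective _ (liStarCont ϖ n z x₀)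
  have hN : 0 < ‖piTilde ϖ ^ (∑ l, n l)‖ := norm_pos_iff.2 (pow_ne_zero _ (piTilde_ne_zero hϖ))
  -- Below half the gap of the monodromy module, so two points of V differ by less than the gap and
  -- V injects.
  obtain ⟨σ, hσ, hσlt⟩ := NormedField.exists_norm_lt (CInfty F) (half_pos hN)
  let g : CInfty F → Fin (d + 1) → CInfty F := fun w j =>
    piTilde ϖ ^ (∑ l ∈ Finset.Iio j, n l) *
      liStar (fun l : Set.Ici j => n l) fun l : Set.Ici j => snocArg z w l
  let a : ∀ j : Fin (d + 1), {i : Set.Ici j → ℕ // Monotone i} → CInfty F := fun j i =>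
    piTilde ϖ ^ (∑ l ∈ Finset.Iio j, n l) *
      ∏ l : Set.Ici j, snocArg z 1 l ^ Fintype.card F ^ i.1 l / carlitzL F (i.1 l) ^ n l
  let e : ∀ j : Fin (d + 1), {i : Set.Ici j → ℕ // Monotone i} → ℕ := fun j i =>
    Fintype.card F ^ i.1 ⟨Fin.last d, Set.mem_Ici.2 (Fin.le_last j)⟩
  have hg : ∀ w, ‖w‖ ≤ ‖ρ₀‖ → ∀ j, HasSum (fun i => a j i * w ^ e j i) (g w j) :=
    fun w hw j => by
      refine ((hasSum_liStar hϖ (hD w hw j)).mul_left _).congr_fun fun i => ?_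
      rw [liStar_term_eq (b := ⟨Fin.last d, Set.mem_Ici.2 (Fin.le_last j)⟩)
        (y' := fun l : Set.Ici j => snocArg z 1 l) (w := w) fun x => ?_, ← mul_assoc]
      rw [snocArg_eq z w]
      simp only [Subtype.ext_iff]
  have hL : ∀ w, ‖w‖ ≤ ‖ρ₀‖ → liStarCont ϖ n z w = Submodule.Quotient.mk (g w) :=
    fun w hw => by
      have h := liStarCont_eq_liStar hϖ (snocArg_castSucc z w) (hD w hw)
      rwa [snocArg_last] at h
  have hbdd : ∀ j, ∃ B, ∀ i, ‖a j i * ρ₀ ^ e j i‖ ≤ B := fun j => by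
    obtain ⟨B, hB⟩ := (summable_iff_tendsto_norm.1
      (hg ρ₀ le_rfl j).summable).bddAbove_range_of_cofinite
    exact ⟨B, fun i => hB ⟨i, rfl⟩⟩
  choose B hB using hbdd
  have hB0 : ∀ j, 0 ≤ B j := fun j =>
    (norm_nonneg _).trans (hB j ⟨fun _ => 0, monotone_const⟩)
  have hS : 0 < ∑ j, B j + 1 :=
    add_pos_of_nonneg_of_pos (Finset.sum_nonneg fun j _ => hB0 j) one_pos
  -- All exponents of w are positive, so shrinking the radius by |μ| ≤ 1 scales the bound B_j of the
  -- terms by at least |μ|; this choice brings the values of g within |σ|.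
  obtain ⟨μ, hμ, hμlt⟩ := NormedField.exists_norm_lt (CInfty F)
    (lt_min one_pos (div_pos hσ hS))
  have hμ1 : ‖μ‖ ≤ 1 := (hμlt.trans_le (min_le_left _ _)).le
  have hμS : ‖μ‖ * (∑ j, B j + 1) ≤ ‖σ‖ :=
    (le_div_iff₀ hS).1 (hμlt.trans_le (min_le_right _ _)).le
  have hρle : ‖μ * ρ₀‖ ≤ ‖ρ₀‖ := by
    rw [norm_mul]
    exact mul_le_of_le_one_left (norm_nonneg _) hμ1
  have hgσ : ∀ w, ‖w‖ ≤ ‖μ * ρ₀‖ → ‖g w‖ ≤ ‖σ‖ := fun w hw => by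
    refine (pi_norm_le_iff_of_nonneg hσ.le).2 fun j => ?_
    rw [← (hg w (hw.trans hρle) j).tsum_eq]
    refine IsUltrametricDist.norm_tsum_le_of_forall_le_of_nonneg hσ.le fun i => ?_
    have he : e j i ≠ 0 := pow_ne_zero _ Fintype.card_ne_zero
    calc ‖a j i * w ^ e j i‖ ≤ ‖a j i‖ * ‖μ * ρ₀‖ ^ e j i := by
          rw [norm_mul, norm_pow]; gcongr
      _ = ‖μ‖ ^ e j i * ‖a j i * ρ₀ ^ e j i‖ := by
          rw [norm_mul μ, norm_mul (a j i), norm_pow, mul_pow]; ring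
      _ ≤ ‖μ‖ * B j := by
          gcongr
          · exact pow_le_of_le_one hμ.le hμ1 he
          · exact hB j i
      _ ≤ ‖μ‖ * (∑ j, B j + 1) := by
          gcongr
          exact (Finset.single_le_sum (fun j _ => hB0 j) (Finset.mem_univ j)).trans
            (le_add_of_nonneg_right zero_le_one)
      _ ≤ ‖σ‖ := hμS
  refine ⟨μ * ρ₀, σ, c, mul_ne_zero (norm_pos_iff.1 hμ) hρ₀, norm_pos_iff.1 hσ, ?_,
    fun x => c + g (x - x₀), fun x hx => ?_, fun x hx => ?_, fun j => ?_⟩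
  · intro v hv v' hv' h
    refine sub_eq_zero.1 (eq_zero_of_mem_monodromy hϖ ((Submodule.Quotient.eq _).1 h) ?_)
    have h1 := Metric.mem_closedBall.1 hv
    have h2 := Metric.mem_closedBall'.1 hv'
    rw [← dist_eq_norm]
    linarith [dist_triangle v c v']
  · rw [Metric.mem_closedBall, dist_eq_norm, add_sub_cancel_left]
    exact hgσ _ (by rwa [← dist_eq_norm, ← Metric.mem_closedBall])
  · have hx' : ‖x - x₀‖ ≤ ‖μ * ρ₀‖ := by rwa [← dist_eq_norm, ← Metric.mem_closedBall]
    -- Additivity: the value at x is the value at x₀, lifted to c, plus the value at the small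
    -- argument x - x₀.
    rw [Submodule.Quotient.mk_add, hc, ← hL _ (hx'.trans hρle),
      ← (isLinearMap_liStarCont hϖ).map_add, add_sub_cancel]
  · refine (isRigidAnalyticOnDisk_of_hasSum (c := a j) (e := e j)
      (f := fun x => g (x - x₀) j) (mul_ne_zero (norm_pos_iff.1 hμ) hρ₀) fun w hw => ?_).const_add _
    rw [add_sub_cancel_left]
    exact hg w (hw.trans hρle) j

end continuation

end
end CarlitzStar


theorem mainTheorem7 {F : Type*} [Field F] [Fintype F] (ϖ : CInfty F)
    (hϖ : ϖ ^ (Fintype.card F - 1) = -theta F) {d : ℕ} (n : Fin (d + 1) → ℕ)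
    (hn : ∀ j, 0 < n j) (z : Fin d → CInfty F) :
    ((∀ (w : CInfty F) (G : Fin (d + 1) → (CInfty F)⟦X⟧),
        IsStarBranch ϖ n (fun j => C (z j)) (C w) G →
          (∀ j, Summable fun i => coeff i (G j) * theta F ^ i) ∧
          liStarCont ϖ n z w = Submodule.Quotient.mk fun j => evalTheta (G j)) ∧
      IsLinearMap F (liStarCont ϖ n z)) ∧
    (∀ y : Fin (d + 1) → CInfty F, (∀ j : Fin d, y j.castSucc = z j) → y ∈ DStar n →
      ((∀ j, z j ≠ 0) ∨
        ∀ j : Fin (d + 1), (fun l : Set.Ici j => y l) ∈ DStar fun l : Set.Ici j => n l) →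
      liStarCont ϖ n z (y (Fin.last d)) = Submodule.Quotient.mk fun j : Fin (d + 1) =>
        piTilde ϖ ^ (∑ l ∈ Finset.Iio j, n l) *
          liStar (fun l : Set.Ici j => n l) fun l : Set.Ici j => y l) ∧
    IsLocallyRigidAnalytic (liStarCont ϖ n z) := by
  refine ⟨⟨fun w G hG => summable_and_liStarCont_eq_mk hϖ hG, isLinearMap_liStarCont hϖ⟩,
    fun y hyz hy h => liStarCont_eq_liStar hϖ hyz ?_, isLocallyRigidAnalytic_liStarCont hϖ n z⟩
  rcases h with h | h
  · exact tail_mem_DStar hy fun j => by rw [hyz]; exact h j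
  · exact h
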